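/- **Setting.** Let $\mathcal A$ be a finite set and $k:\mathcal A\times\mathcal A\to\mathbb R$ a symmetric positive semidefinite kernel. Let $\lambda\ge 1$. For candidates $x_1,\dots,x_t\in\mathcal A$ put $K_t=[k(x_i,x_j)]_{i,j\le t}$ and $k_t(x)=(k(x_1,x),\dots,k(x_t,x))^{\mathsf T}$. The exact posterior standard deviation is $$\sigma_t(x)=\Big(\tfrac1\lambda\big(k(x,x)-k_t(x)^{\mathsf T}(K_t+\lambda I)^{-1}k_t(x)\big)\Big)^{1/2},\qquad \rho_{\tau,t}(x)=\frac{\sigma_\tau(x)}{\sigma_t(x)}$$ (with $0/0=0$; for $\tau\le t$ the denominator vanishes only if the numerator does). For a dictionary $\mathcal S\subseteq\mathcal A$ let $z(x,\mathcal S)=K_{\mathcal S}^{+/2}k_{\mathcal S}(x)$, where $K_{\mathcal S}^{+/2}$ is the square root of the pseudo-inverse of the kernel matrix of $\mathcal S$ and $k_{\mathcal S}(x)=(k(a,x))_{a\in\mathcal S}$. Let $Z_t$ be the matrix with rows $z(x_1,\mathcal S)^{\mathsf T},\dots,z(x_t,\mathcal S)^{\mathsf T}$, $V_t=Z_t^{\mathsf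 T}Z_t+\lambda I$, and $$\tilde\mu_t(x,\mathcal S)=z(x,\mathcal S)^{\mathsf T}V_t^{-1}Z_t^{\mathsf T}y_t,\quad y_t=(y_1,\dots,y_t)^{\mathsf T},$$ $$\tilde\sigma_t(x,\mathcal S)^2=\tfrac1\lambda\big(k(x,x)-\|z(x,\mathcal S)\|^2\big)+z(x,\mathcal S)^{\mathsf T}V_t^{-1}z(x,\mathcal S).$$ **Algorithm (BBKB).** Fix a horizon $T$, a threshold $\tilde C\ge1$, an exponent $p\in\{1,2\}$ ($p=1$: termination rule with standard deviations; $p=2$: with variances) and parameters $\bar q_1,\dots,\bar q_T$. The feedback for $x_s$ is $y_s=f(x_s)+\eta_s$, with $f:\mathcal A\to\mathbb R$ and i.i.d. Gaussian noise $\eta_s$ of mean zero, independent of everything that precedes it. Start with $\mathrm{fb}(0)=0$, $\mathcal S_0=\emptyset$ and an arbitrary (possibly random) first candidate $x_1$. For $t=0,\dots,T-1$: * if $t\ge1$, choose $x_{t+1}\in\arg\max_{x\in\mathcal A}\ \tilde\mu_{\mathrm{fb}(t)}(x,\mathcal S_{\mathrm{fb}(t)})+\tilde\alpha_{\mathrm{fb}(t)}\,\tilde\sigma_t(x,\mathcal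 S_{\mathrm{fb}(t)})$, where $\tilde\alpha_{\mathrm{fb}(t)}$ may depend on the past; * if $1+\sum_{s=\mathrm{fb}(t)+1}^{t+1}\tilde\sigma_{\mathrm{fb}(t)}(x_s,\mathcal S_{\mathrm{fb}(t)})^p\le\tilde C$, put $\mathrm{fb}(t+1)=\mathrm{fb}(t)$ and keep the dictionary; * otherwise put $\mathrm{fb}(t+1)=t+1$ and let $\mathcal S_{t+1}$ be the set of those $x_s$ ($1\le s\le t+1$) with $z_{t+1,s}=1$, where, given the past, the $z_{t+1,s}$ are independent Bernoulli variables with parameters $\min\{1,\ \bar q_{t+1}\,\tilde\sigma_{\mathrm{fb}(t)}(x_s,\mathcal S_{\mathrm{fb}(t)})^2\}$. **Lemma.** Let $0<\delta<1$ and $\bar q_t\ge 8\log(4t/\delta)$ for $1\le t\le T$. Then with probability at least $1-\delta$, simultaneously for all $0\le t\le T$ and all $x\in\mathcal A$, $$\rho_{\mathrm{fb}(t),t}(x)^j\ \le\ 3\Big(1+\sum_{s=\mathrm{fb}(t)+1}^{t}\tilde\sigma_{\mathrm{fb}(t)}(x_s,\mathcal S_{\mathrm{fb}(t)})^j\Big)\qquad\text{for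 both } j=1 \text{ (standard deviations) and } j=2 \text{ (variances)},$$ and, for the exponent $p$ of the termination rule, $\rho_{\mathrm{fb}(t),t}(x)^p\le 3\tilde C$. -/

import Mathlib

open MeasureTheory ProbabilityTheory

noncomputable section

namespace BBKB

section Posterior

variable {A : Type*}

/-- The kernel matrix `K_S` of a dictionary `S`. -/
def dictKernel (k : A → A → ℝ) (S : Finset A) : Matrix S S ℝ :=
  Matrix.of fun a b => k a b

/-- `M^{+/2}`, the square root of the pseudo-inverse of a positive semidefinite matrix, by spectral
calculus: the eigenvalue `v` becomes `v^{-1/2}` if `v > 0`, and `0` if `v = 0`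
(`(√0)⁻¹ = 0` in Mathlib). -/
def pinvSqrt {n : Type*} [Fintype n] [DecidableEq n] (M : Matrix n n ℝ) : Matrix n n ℝ :=
  cfc (fun v : ℝ => (Real.sqrt v)⁻¹) M

variable [DecidableEq A]

/-- The Nyström embedding `z(a, S) = K_S^{+/2} k_S(a)`. -/
def embed (k : A → A → ℝ) (S : Finset A) (a : A) : S → ℝ :=
  (pinvSqrt (dictKernel k S)).mulVec fun b => k b a

/-- `Z(X_t, S)`, with rows `z(x_1, S), …, z(x_t, S)`. -/
def embedMatrix (k : A → A → ℝ) (x : ℕ → A) (t : ℕ) (S : Finset A) : Matrix (Fin t) S ℝ :=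
  Matrix.of fun i => embed k S (x (i + 1))

/-- `V_t = Z(X_t, S)ᵀ Z(X_t, S) + λ I`. -/
def V (k : A → A → ℝ) (lam : ℝ) (x : ℕ → A) (t : ℕ) (S : Finset A) : Matrix S S ℝ :=
  (embedMatrix k x t S).transpose * embedMatrix k x t S + lam • 1

/-- The approximate posterior mean `μ̃_t(a, S) = z(a, S)ᵀ V_t⁻¹ Z(X_t, S)ᵀ y_t`. -/
def approxMean (k : A → A → ℝ) (lam : ℝ) (x : ℕ → A) (y : ℕ → ℝ) (t : ℕ) (S : Finset A)
    (a : A) : ℝ :=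
  embed k S a ⬝ᵥ
    (V k lam x t S)⁻¹.mulVec ((embedMatrix k x t S).transpose.mulVec fun i => y (i + 1))

/-- The approximate posterior covariance `k̃_t(a, b, S)`. -/
def approxCov (k : A → A → ℝ) (lam : ℝ) (x : ℕ → A) (t : ℕ) (S : Finset A) (a b : A) : ℝ :=
  (1 / lam) * (k a b - embed k S a ⬝ᵥ embed k S b)
    + embed k S a ⬝ᵥ (V k lam x t S)⁻¹.mulVec (embed k S b)

/-- The approximate posterior standard deviation `σ̃_t(a, S)`. -/
def approxSigma (k : A → A → ℝ) (lam : ℝ) (x : ℕ → A) (t : ℕ) (S : Finset A) (a : A) : ℝ :=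
  Real.sqrt (approxCov k lam x t S a a)

end Posterior

section Exact

variable {A : Type*}

/-- The kernel matrix `K_t` of the candidates `x_1, …, x_t`. -/
def gram (k : A → A → ℝ) (x : ℕ → A) (t : ℕ) : Matrix (Fin t) (Fin t) ℝ :=
  Matrix.of fun i j => k (x (i + 1)) (x (j + 1))

/-- `k_t(a) = (k(x_1, a), …, k(x_t, a))`. -/
def kvec (k : A → A → ℝ) (x : ℕ → A) (t : ℕ) (a : A) : Fin t → ℝ :=
  fun i => k (x (i + 1)) a

/-- The exact posterior standard deviation `σ_t(a)`, with
`σ_t(a)² = (k(a, a) - k_t(a)ᵀ (K_t + λ I)⁻¹ k_t(a)) / λ`. -/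
def exactSigma (k : A → A → ℝ) (lam : ℝ) (x : ℕ → A) (t : ℕ) (a : A) : ℝ :=
  Real.sqrt ((1 / lam) *
    (k a a - kvec k x t a ⬝ᵥ (gram k x t + lam • 1)⁻¹.mulVec (kvec k x t a)))

/-- The exact posterior ratio `ρ_{τ,t}(a) = σ_τ(a) / σ_t(a)`. -/
def exactRatio (k : A → A → ℝ) (lam : ℝ) (x : ℕ → A) (τ t : ℕ) (a : A) : ℝ :=
  exactSigma k lam x τ a / exactSigma k lam x t a

end Exact

/-- The random quantities produced by the algorithm on a probability space. -/
structure Trajectory (Ω A : Type*) where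
  /-- `x t` is the candidate `x_t` selected at step `t ≥ 1` (`x 0` is not used). -/
  x : ℕ → Ω → A
  /-- `fb t` is the last step of the batch before the one that step `t` belongs to. -/
  fb : ℕ → Ω → ℕ
  /-- `z t` is the set of the indices `s` with `z_{t,s} = 1` (used if `t` is a
  resparsification step). -/
  z : ℕ → Ω → Finset ℕ
  /-- `η t` is the noise in the feedback for `x_t`, `t ≥ 1`. -/
  η : ℕ → Ω → ℝ
  /-- `α t` is the exploration parameter `α̃_t`, which may depend on the data. -/
  α : ℕ → Ω → ℝ

namespace Trajectory

variable {Ω A : Type*} [DecidableEq A] (R : Trajectory Ω A)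

/-- The trajectory `x_1, x_2, …` for the outcome `ω`. -/
def path (ω : Ω) : ℕ → A := fun s => R.x s ω

/-- The dictionary `S_{fb(t)}` in use after step `t`. -/
def dict (t : ℕ) (ω : Ω) : Finset A := (R.z (R.fb t ω) ω).image (R.path ω)

/-- `σ̃_{fb(t)}(a, S_{fb(t)})`, the approximate standard deviation at the start of the batch. -/
def batchSigma (k : A → A → ℝ) (lam : ℝ) (t : ℕ) (ω : Ω) (a : A) : ℝ :=
  approxSigma k lam (R.path ω) (R.fb t ω) (R.dict t ω) a

/-- The acquisition function
`ũ_t(a) = μ̃_{fb(t)}(a, S_{fb(t)}) + α̃_{fb(t)} σ̃_t(a, S_{fb(t)})`, where the feedback is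
`y_s = f(x_s) + η_s`. -/
def ucb (k : A → A → ℝ) (lam : ℝ) (f : A → ℝ) (t : ℕ) (ω : Ω) (a : A) : ℝ :=
  approxMean k lam (R.path ω) (fun s => f (R.x s ω) + R.η s ω) (R.fb t ω) (R.dict t ω) a
    + R.α (R.fb t ω) ω * approxSigma k lam (R.path ω) t (R.dict t ω) a

/-- The probability with which `x_s` enters the dictionary if the algorithm resparsifies at step
`t + 1`: `q̄_{t+1} σ̃_{fb(t)}(x_s, S_{fb(t)})²`, capped at `1`. -/
def inclusionProb (k : A → A → ℝ) (lam : ℝ) (q : ℕ → ℝ) (t : ℕ) (ω : Ω) (s : ℕ) : ℝ :=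
  min 1 (q (t + 1) * R.batchSigma k lam t ω (R.x s ω) ^ 2)

/-- `R` is a run of BBKB over the horizon `T`, with kernel `k`, regularization `lam`, threshold
`C`, sampling parameters `q`, reward function `f` and noise variance `v`. The `σ`-algebra `ℱ t`
holds everything that is determined before the sampling of the dictionary at step `t`.
The terms of the sum in the batch termination rule are raised to the power `p`: `p = 1` is the
rule written with standard deviations, `p = 2` the one written with variances. -/
structure IsRun {m : MeasurableSpace Ω} (μ : Measure Ω) (ℱ : Filtration ℕ m)
    (k : A → A → ℝ) (lam C : ℝ) (p : ℕ) (q : ℕ → ℝ) (f : A → ℝ) (v : NNReal) (T : ℕ) : Prop where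
  measurable_x : ∀ t < T, ∀ a, MeasurableSet[ℱ (t + 1)] {ω | R.x (t + 1) ω = a}
  measurable_fb : ∀ t ≤ T, ∀ j, MeasurableSet[ℱ t] {ω | R.fb t ω = j}
  measurable_z : ∀ t ≤ T, ∀ J, MeasurableSet[ℱ (t + 1)] {ω | R.z t ω = J}
  measurable_η : ∀ t < T, Measurable[ℱ (t + 2)] (R.η (t + 1))
  measurable_α : ∀ t ≤ T, Measurable[ℱ (t + 1)] (R.α t)
  /-- The noise is Gaussian and independent of the past. -/
  law_η : ∀ t < T, μ.map (R.η (t + 1)) = gaussianReal 0 v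
  indep_η : ∀ t < T, Indep (MeasurableSpace.comap (R.η (t + 1)) inferInstance)
    (ℱ (t + 1) ⊔ MeasurableSpace.comap (R.z (t + 1)) ⊤) μ
  /-- Initialization: `fb(0) = 0` and `S_0 = ∅`. -/
  fb_zero : ∀ ω, R.fb 0 ω = 0
  z_zero : ∀ ω, R.z 0 ω = ∅
  /-- Selection of `x_{t+1}`, `t ≥ 1`; the first candidate is arbitrary. -/
  argmax : ∀ t, 1 ≤ t → t < T → ∀ ω a,
    R.ucb k lam f t ω a ≤ R.ucb k lam f t ω (R.x (t + 1) ω)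
  /-- The batch termination rule. -/
  fb_succ : ∀ t < T, ∀ ω, R.fb (t + 1) ω =
    if 1 + ∑ s ∈ Finset.Icc (R.fb t ω + 1) (t + 1), R.batchSigma k lam t ω (R.x s ω) ^ p ≤ C
    then R.fb t ω else t + 1
  /-- If step `t + 1` resparsifies then, given the past, `z_{t+1,1}, …, z_{t+1,t+1}` are
  independent Bernoulli variables with parameters `inclusionProb`. -/
  law_z : ∀ t < T, ∀ J ⊆ Finset.Icc 1 (t + 1),
    μ[Set.indicator {ω | R.fb (t + 1) ω = t + 1 ∧ R.z (t + 1) ω = J} (fun _ => (1 : ℝ))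
        | ℱ (t + 1)]
      =ᵐ[μ] Set.indicator {ω | R.fb (t + 1) ω = t + 1} (fun ω =>
        (∏ s ∈ J, R.inclusionProb k lam q t ω s)
          * ∏ s ∈ Finset.Icc 1 (t + 1) \ J, (1 - R.inclusionProb k lam q t ω s))

end Trajectory

end BBKB

end

/-! Write k(a,b) = φ(a)·φ(b) and E_t(u) = Σ_{s≤t} (φ(x_s)·u)². Then σ_t(a)² is the value at φ(a) of
the inverse of the form E_t(u) + λ|u|², and σ̃_t(a,S)² is the same for E_t(Pu) + λ|u|², with P the
projection onto the span of φ(S). A dictionary covers at level c if E_t(u) ≤ cλ|u|² for all u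
orthogonal to it. Level 4/3 gives σ_τ² ≤ 3σ̃_τ² (`exactSigma_sq_le_approxSigma_sq`), and σ_τ² ≤ (1 +
Σσ_τ(x_s)²)σ_t² always (`exactSigma_sq_le`), so the ratio bounds hold on every path whose
dictionaries all cover at level 4/3. It remains to bound the probability of the other paths.

One resampling (`sum_sampleWeight_missed_le`): after whitening by the old approximate form, x_s is a
vector ψ_s drawn with probability min(1, q|ψ_s|²). Run through the indices, adding qψ_sψ_sᵀ to an
operator and cutting the space down to the complement of each drawn vector. The trace of the
exponential of the compressed operator is a supermartingale: ψ_s raises part of it by a factor of at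
most e^{q|ψ_s|²}, but only if it is not drawn, which has probability at most e^{-q|ψ_s|²}. A missed
direction of relative energy κ forces a final trace of at least e^{qκ}, so its probability is at
most n·e^{-qκ}.

All resamplings (`potential_succ_le`): from level 4/3 to level 4/3 this bound is of order n^{-27/40}
at step n, which is not summable. Two levels repair this. A dictionary of level 2/3 is followed by
one missing level 4/3 with probability of order n^{-9/8}, and by one missing level 2/3 with order
n^{-9/20}. A weak dictionary (level 4/3 but not 2/3) fails next with order n^{-27/40}, and
n^{-9/20}·n^{-27/40} = n^{-9/8}. Charging every weak dictionary a penalty in advance gives a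
potential with summable increments. -/

noncomputable section

namespace BBKB

/-! ### Trace exponential of compressed operators. -/

section TraceExp

open scoped InnerProductSpace

variable {E : Type*} [NormedAddCommGroup E] [InnerProductSpace ℝ E]

/-- The operator `a aᵀ`. -/
def outer (a : E) : E →ₗ[ℝ] E := (InnerProductSpace.rankOne ℝ a a : E →L[ℝ] E)

lemma inner_outer (a u v : E) : ⟪u, outer a v⟫_ℝ = ⟪a, u⟫_ℝ * ⟪a, v⟫_ℝ := by
  simp [outer, inner_smul_right, real_inner_comm, mul_comm]

lemma isSymmetric_outer (a : E) : (outer a).IsSymmetric := by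
  intro u v
  rw [real_inner_comm, inner_outer, inner_outer, mul_comm]

lemma isSymmetric_real_smul {H : E →ₗ[ℝ] E} (hH : H.IsSymmetric) (r : ℝ) :
    (r • H).IsSymmetric := by
  intro u v
  simp [inner_smul_left, inner_smul_right, hH u v]

lemma isSymmetric_add_smul_outer {H : E →ₗ[ℝ] E} (hH : H.IsSymmetric) (r : ℝ) (a : E) :
    (H + r • outer a).IsSymmetric :=
  hH.add (isSymmetric_real_smul (isSymmetric_outer a) r)

lemma isSymmetric_add_smul_sum_outer {ι : Type*} {H : E →ₗ[ℝ] E} (hH : H.IsSymmetric) (r : ℝ)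
    (s : Finset ι) (a : ι → E) : (H + r • ∑ i ∈ s, outer (a i)).IsSymmetric := by
  refine hH.add (isSymmetric_real_smul ?_ r)
  intro u v
  simp only [LinearMap.sum_apply, sum_inner, inner_sum]
  exact Finset.sum_congr rfl fun i _ => isSymmetric_outer (a i) u v

/-- The trace of the exponential of the compression of `H` to the subspace `U`, by its variational
characterization. -/
def expTrace (U : Submodule ℝ E) (H : E →ₗ[ℝ] E) : ℝ :=
  sSup {r | ∃ (n : ℕ) (g : Fin n → E), Orthonormal ℝ g ∧ (∀ i, g i ∈ U) ∧
    r = ∑ i, Real.exp ⟪g i, H (g i)⟫_ℝ}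

lemma expTrace_congr {U : Submodule ℝ E} {H H' : E →ₗ[ℝ] E}
    (h : ∀ u ∈ U, ⟪u, H u⟫_ℝ = ⟪u, H' u⟫_ℝ) : expTrace U H = expTrace U H' := by
  unfold expTrace
  congr 1
  ext r
  refine exists_congr fun n => exists_congr fun g => and_congr_right fun _ =>
    and_congr_right fun hg => ?_
  rw [Finset.sum_congr rfl fun i _ => by rw [h (g i) (hg i)]]

lemma sum_inner_sq_le {ι : Type*} [Fintype ι] {g : ι → E} (hg : Orthonormal ℝ g) (u : E) :
    ∑ i, ⟪g i, u⟫_ℝ ^ 2 ≤ ‖u‖ ^ 2 := by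
  have := hg.sum_inner_products_le (s := Finset.univ) u
  simpa using this

lemma expTrace_inf_orthogonal (U : Submodule ℝ E) (H : E →ₗ[ℝ] E) (r : ℝ) (a : E) :
    expTrace (U ⊓ (ℝ ∙ a)ᗮ) (H + r • outer a) = expTrace (U ⊓ (ℝ ∙ a)ᗮ) H := by
  refine expTrace_congr fun u hu => ?_
  have : ⟪a, u⟫_ℝ = 0 := Submodule.mem_orthogonal_singleton_iff_inner_right.1 hu.2
  simp [inner_add_right, inner_smul_right, inner_outer, this]

variable [FiniteDimensional ℝ E]

/-- A symmetric operator is diagonalizable on every subspace. -/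
lemma exists_orthonormal_diag (U : Submodule ℝ E) {H : E →ₗ[ℝ] E} (hH : H.IsSymmetric) :
    ∃ (n : ℕ) (g : Fin n → E) (ν : Fin n → ℝ), Orthonormal ℝ g ∧ (∀ i, g i ∈ U) ∧
      n = Module.finrank ℝ U ∧
      (∀ u ∈ U, ⟪u, H u⟫_ℝ = ∑ i, ν i * ⟪g i, u⟫_ℝ ^ 2) ∧
      (∀ u ∈ U, ‖u‖ ^ 2 = ∑ i, ⟪g i, u⟫_ℝ ^ 2) := by
  let T : U →ₗ[ℝ] U := (U.orthogonalProjectionOnto : E →L[ℝ] U).toLinearMap ∘ₗ H ∘ₗ U.subtype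
  have hTi : ∀ u v : U, ⟪u, T v⟫_ℝ = ⟪(u : E), H v⟫_ℝ := by
    intro u v
    simp [T]
  have hT : T.IsSymmetric := by
    intro u v
    rw [real_inner_comm, hTi, hTi, real_inner_comm, hH]
  let b := hT.eigenvectorBasis rfl
  refine ⟨_, fun i => (b i : E), hT.eigenvalues rfl, ?_, fun i => (b i).2, rfl, ?_, ?_⟩
  · exact b.orthonormal.comp_linearIsometry U.subtypeₗᵢ
  · intro u hu
    have h1 := hTi ⟨u, hu⟩ ⟨u, hu⟩
    rw [← h1, ← b.sum_inner_mul_inner]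
    refine Finset.sum_congr rfl fun i _ => ?_
    have h2 : ⟪b i, T ⟨u, hu⟩⟫_ℝ = hT.eigenvalues rfl i * ⟪b i, (⟨u, hu⟩ : U)⟫_ℝ := by
      have := hT.eigenvectorBasis_apply_self_apply rfl ⟨u, hu⟩ i
      rwa [OrthonormalBasis.repr_apply_apply, OrthonormalBasis.repr_apply_apply] at this
    rw [h2, real_inner_comm]
    simp only [Submodule.coe_inner]
    ring
  · intro u hu
    have := b.sum_sq_norm_inner_right (⟨u, hu⟩ : U)
    simp only [Real.norm_eq_abs, sq_abs] at this
    simpa using this.symm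

/-- Jensen's inequality for the spectral measure of a unit vector. -/
lemma exp_sum_le {n : ℕ} {ν c : Fin n → ℝ} (h0 : ∀ i, 0 ≤ c i) (h1 : ∑ i, c i = 1) :
    Real.exp (∑ i, ν i * c i) ≤ ∑ i, Real.exp (ν i) * c i := by
  have := convexOn_exp.map_sum_le (t := Finset.univ) (w := c) (p := ν) (fun i _ => h0 i) h1
    (fun i _ => Set.mem_univ _)
  simpa [mul_comm] using this

/-- Jensen's inequality for the spectral measure of a unit vector, then Bessel's inequality for the
weight on each eigenvector, show that the eigenbasis of the compression attains the supremum. The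
Jensen bound is exported because the eigenbasis is reused as a test family. -/
lemma expTrace_spec (U : Submodule ℝ E) {H : E →ₗ[ℝ] E} (hH : H.IsSymmetric) :
    (∃ (n : ℕ) (g : Fin n → E), Orthonormal ℝ g ∧ (∀ i, g i ∈ U) ∧ n = Module.finrank ℝ U ∧
      expTrace U H = ∑ i, Real.exp ⟪g i, H (g i)⟫_ℝ ∧
      ∀ u ∈ U, ‖u‖ = 1 →
        Real.exp ⟪u, H u⟫_ℝ ≤ ∑ i, Real.exp ⟪g i, H (g i)⟫_ℝ * ⟪g i, u⟫_ℝ ^ 2) ∧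
    ∀ (n : ℕ) (g : Fin n → E), Orthonormal ℝ g → (∀ i, g i ∈ U) →
      ∑ i, Real.exp ⟪g i, H (g i)⟫_ℝ ≤ expTrace U H := by
  obtain ⟨n, g, ν, hg, hgU, hn, hform, hnorm⟩ := exists_orthonormal_diag U hH
  have hν : ∀ i, ⟪g i, H (g i)⟫_ℝ = ν i := by
    intro i
    rw [hform _ (hgU i), Finset.sum_eq_single i]
    · simp [hg.1 i]
    · intro j _ hj
      simp [hg.2 hj]
    · simp
  have hJ : ∀ u ∈ U, ‖u‖ = 1 →
      Real.exp ⟪u, H u⟫_ℝ ≤ ∑ i, Real.exp ⟪g i, H (g i)⟫_ℝ * ⟪g i, u⟫_ℝ ^ 2 := by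
    intro u hu h1
    simp only [hν]
    rw [hform u hu]
    exact exp_sum_le (fun i => sq_nonneg _) (by rw [← hnorm u hu, h1, one_pow])
  have hub : ∀ (m : ℕ) (f : Fin m → E), Orthonormal ℝ f → (∀ i, f i ∈ U) →
      ∑ i, Real.exp ⟪f i, H (f i)⟫_ℝ ≤ ∑ i, Real.exp ⟪g i, H (g i)⟫_ℝ := by
    intro m f hf hfU
    calc ∑ i, Real.exp ⟪f i, H (f i)⟫_ℝ
        ≤ ∑ i, ∑ j, Real.exp ⟪g j, H (g j)⟫_ℝ * ⟪g j, f i⟫_ℝ ^ 2 :=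
          Finset.sum_le_sum fun i _ => hJ _ (hfU i) (hf.1 i)
      _ = ∑ j, Real.exp ⟪g j, H (g j)⟫_ℝ * ∑ i, ⟪f i, g j⟫_ℝ ^ 2 := by
          rw [Finset.sum_comm]
          simp only [Finset.mul_sum, real_inner_comm]
      _ ≤ ∑ j, Real.exp ⟪g j, H (g j)⟫_ℝ * 1 := by
          refine Finset.sum_le_sum fun j _ => ?_
          gcongr
          simpa [hg.1 j] using sum_inner_sq_le hf (g j)
      _ = _ := by simp
  have hgr : IsGreatest {r | ∃ (n : ℕ) (g : Fin n → E), Orthonormal ℝ g ∧ (∀ i, g i ∈ U) ∧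
      r = ∑ i, Real.exp ⟪g i, H (g i)⟫_ℝ} (∑ i, Real.exp ⟪g i, H (g i)⟫_ℝ) := by
    refine ⟨⟨n, g, hg, hgU, rfl⟩, ?_⟩
    rintro r ⟨m, f, hf, hfU, rfl⟩
    exact hub m f hf hfU
  have he : expTrace U H = ∑ i, Real.exp ⟪g i, H (g i)⟫_ℝ := hgr.csSup_eq
  exact ⟨⟨n, g, hg, hgU, hn, he, hJ⟩, fun m f hf hfU => he ▸ hub m f hf hfU⟩

lemma expTrace_nonneg (U : Submodule ℝ E) {H : E →ₗ[ℝ] E} (hH : H.IsSymmetric) :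
    0 ≤ expTrace U H := by
  obtain ⟨⟨n, g, -, -, -, h, -⟩, -⟩ := expTrace_spec U hH
  rw [h]
  exact Finset.sum_nonneg fun i _ => (Real.exp_pos _).le

lemma expTrace_zero (U : Submodule ℝ E) :
    expTrace U (0 : E →ₗ[ℝ] E) = Module.finrank ℝ U := by
  obtain ⟨⟨n, g, -, -, hn, h, -⟩, -⟩ := expTrace_spec U (H := (0 : E →ₗ[ℝ] E)) (by intro; simp)
  rw [h, ← hn]
  simp

lemma exp_le_expTrace {U : Submodule ℝ E} {H : E →ₗ[ℝ] E} (hH : H.IsSymmetric) {w : E}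
    (hw : w ∈ U) (hw0 : w ≠ 0) {κ : ℝ} (h : κ * ‖w‖ ^ 2 ≤ ⟪w, H w⟫_ℝ) :
    Real.exp κ ≤ expTrace U H := by
  have hn : 0 < ‖w‖ := norm_pos_iff.2 hw0
  have := (expTrace_spec U hH).2 1 (fun _ => ‖w‖⁻¹ • w)
    ⟨fun _ => by rw [norm_smul]; simp [hn.ne'], fun i j hij => (hij (Subsingleton.elim i j)).elim⟩
    (fun _ => U.smul_mem _ hw)
  have hκ : κ ≤ ⟪‖w‖⁻¹ • w, H (‖w‖⁻¹ • w)⟫_ℝ := by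
    rw [map_smul, real_inner_smul_left, real_inner_smul_right, ← mul_assoc]
    calc κ = ‖w‖⁻¹ * ‖w‖⁻¹ * (κ * ‖w‖ ^ 2) := by field_simp
      _ ≤ _ := by gcongr
  exact (Real.exp_le_exp.2 hκ).trans (by simpa using this)

/-- The part of `exp H` in the direction `a` is at most what the trace loses on `a`'s orthogonal
complement. -/
lemma expTrace_direction (U : Submodule ℝ E) {H : E →ₗ[ℝ] E} (hH : H.IsSymmetric) (a : E)
    {n : ℕ} {g : Fin n → E} (hg : Orthonormal ℝ g)
    (he : expTrace U H = ∑ i, Real.exp ⟪g i, H (g i)⟫_ℝ)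
    (hJ : ∀ u ∈ U, ‖u‖ = 1 →
        Real.exp ⟪u, H u⟫_ℝ ≤ ∑ i, Real.exp ⟪g i, H (g i)⟫_ℝ * ⟪g i, u⟫_ℝ ^ 2) :
    ∑ i, Real.exp ⟪g i, H (g i)⟫_ℝ * ⟪g i, a⟫_ℝ ^ 2 ≤
      ‖a‖ ^ 2 * (expTrace U H - expTrace (U ⊓ (ℝ ∙ a)ᗮ) H) := by
  obtain ⟨⟨m, f, hf, hfU, -, hef, -⟩, -⟩ := expTrace_spec (U ⊓ (ℝ ∙ a)ᗮ) hH
  have hle : expTrace (U ⊓ (ℝ ∙ a)ᗮ) H ≤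
      ∑ j, Real.exp ⟪g j, H (g j)⟫_ℝ * ∑ i, ⟪f i, g j⟫_ℝ ^ 2 := by
    rw [hef]
    calc _ ≤ ∑ i, ∑ j, Real.exp ⟪g j, H (g j)⟫_ℝ * ⟪g j, f i⟫_ℝ ^ 2 :=
          Finset.sum_le_sum fun i _ => hJ _ (hfU i).1 (hf.1 i)
      _ = _ := by
          rw [Finset.sum_comm]
          simp only [Finset.mul_sum, real_inner_comm]
  -- The `f i` are orthogonal to `a`, so `g j` and its residual off their span have the same inner
  -- product with `a`; Cauchy–Schwarz applies to the residual.
  have key : ∀ j, ⟪g j, a⟫_ℝ ^ 2 ≤ ‖a‖ ^ 2 * (1 - ∑ i, ⟪f i, g j⟫_ℝ ^ 2) := by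
    intro j
    have hfa : ∀ i, ⟪f i, a⟫_ℝ = 0 := fun i =>
      Submodule.mem_orthogonal_singleton_iff_inner_left.1 (hfU i).2
    set r := g j - ∑ i, ⟪f i, g j⟫_ℝ • f i with hr
    have h1 : ⟪r, a⟫_ℝ = ⟪g j, a⟫_ℝ := by
      simp [hr, inner_sub_left, sum_inner, inner_smul_left, hfa]
    have h2 : ‖r‖ ^ 2 = 1 - ∑ i, ⟪f i, g j⟫_ℝ ^ 2 := by
      rw [hr, norm_sub_sq_real, hg.1 j]
      have h3 : ⟪g j, ∑ i, ⟪f i, g j⟫_ℝ • f i⟫_ℝ = ∑ i, ⟪f i, g j⟫_ℝ ^ 2 := by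
        rw [inner_sum]
        refine Finset.sum_congr rfl fun i _ => ?_
        rw [real_inner_smul_right, real_inner_comm, sq]
      have h4 : ‖∑ i, ⟪f i, g j⟫_ℝ • f i‖ ^ 2 = ∑ i, ⟪f i, g j⟫_ℝ ^ 2 := by
        rw [← real_inner_self_eq_norm_sq, hf.inner_sum]
        simp [sq]
      rw [h3, h4]
      ring
    rw [← h1, ← h2, ← sq_abs, ← mul_pow]
    gcongr
    rw [mul_comm]
    exact abs_real_inner_le_norm r a
  calc ∑ i, Real.exp ⟪g i, H (g i)⟫_ℝ * ⟪g i, a⟫_ℝ ^ 2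
      ≤ ∑ j, Real.exp ⟪g j, H (g j)⟫_ℝ * (‖a‖ ^ 2 * (1 - ∑ i, ⟪f i, g j⟫_ℝ ^ 2)) := by
        gcongr with j _
        exact key j
    _ = ‖a‖ ^ 2 * (expTrace U H - ∑ j, Real.exp ⟪g j, H (g j)⟫_ℝ * ∑ i, ⟪f i, g j⟫_ℝ ^ 2) := by
        rw [he, ← Finset.sum_sub_distrib, Finset.mul_sum]
        exact Finset.sum_congr rfl fun j _ => by ring
    _ ≤ _ := by gcongr

lemma expTrace_inf_le (U : Submodule ℝ E) {H : E →ₗ[ℝ] E} (hH : H.IsSymmetric) (a : E) :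
    expTrace (U ⊓ (ℝ ∙ a)ᗮ) H ≤ expTrace U H := by
  obtain ⟨⟨m, f, hf, hfU, -, hef, -⟩, -⟩ := expTrace_spec (U ⊓ (ℝ ∙ a)ᗮ) hH
  rw [hef]
  exact (expTrace_spec U hH).2 m f hf fun i => (hfU i).1

/-- The eigenbasis of `H` is a test family for the perturbed operator. Then `exp y ≥ 1 + y` gives
the first-order bound, and `expTrace_direction` controls the linear term. -/
lemma expTrace_sub_smul_outer (U : Submodule ℝ E) {H : E →ₗ[ℝ] E} (hH : H.IsSymmetric) (a : E)
    {h : ℝ} (h0 : 0 ≤ h) :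
    expTrace U H - h * (‖a‖ ^ 2 * (expTrace U H - expTrace (U ⊓ (ℝ ∙ a)ᗮ) H)) ≤
      expTrace U (H + (-h) • outer a) := by
  obtain ⟨⟨n, g, hg, hgU, -, he, hJ⟩, -⟩ := expTrace_spec U hH
  have hd := expTrace_direction U hH a hg he hJ
  have hl := (expTrace_spec U (isSymmetric_add_smul_outer hH (-h) a)).2 n g hg hgU
  refine le_trans ?_ hl
  calc _ ≤ expTrace U H - h * ∑ i, Real.exp ⟪g i, H (g i)⟫_ℝ * ⟪g i, a⟫_ℝ ^ 2 := by gcongr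
    _ = ∑ i, Real.exp ⟪g i, H (g i)⟫_ℝ * (-h * ⟪g i, a⟫_ℝ ^ 2 + 1) := by
        rw [he, Finset.mul_sum, ← Finset.sum_sub_distrib]
        exact Finset.sum_congr rfl fun j _ => by ring
    _ ≤ ∑ i, Real.exp ⟪g i, H (g i)⟫_ℝ * Real.exp (-h * ⟪g i, a⟫_ℝ ^ 2) := by
        gcongr
        exact Real.add_one_le_exp _
    _ = _ := by
        refine Finset.sum_congr rfl fun j _ => ?_
        rw [← Real.exp_add]
        simp only [LinearMap.add_apply, LinearMap.smul_apply, inner_add_right, inner_smul_right,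
          inner_outer, real_inner_comm, sq]

/-- Adding `q a aᵀ` to `H` multiplies the trace outside of `a`'s orthogonal complement by at most
`exp (q ‖a‖²)`. -/
lemma expTrace_add_smul_outer (U : Submodule ℝ E) {H : E →ₗ[ℝ] E} (hH : H.IsSymmetric) (a : E)
    {q : ℝ} (hq : 0 ≤ q) :
    expTrace U (H + q • outer a) - expTrace (U ⊓ (ℝ ∙ a)ᗮ) H ≤
      Real.exp (q * ‖a‖ ^ 2) * (expTrace U H - expTrace (U ⊓ (ℝ ∙ a)ᗮ) H) := by
  set W : ℝ → ℝ := fun r => expTrace U (H + r • outer a) - expTrace (U ⊓ (ℝ ∙ a)ᗮ) H with hW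
  have hW0 : W 0 = expTrace U H - expTrace (U ⊓ (ℝ ∙ a)ᗮ) H := by simp [hW]
  -- The trace on the complement of `a` does not depend on `r`, so this is a discrete form of W' ≤
  -- ‖a‖² W. Applying it n times with step q/n and letting n → ∞ gives the exponential factor.
  have hstep : ∀ r h, 0 ≤ h → W (r + h) * (1 - h * ‖a‖ ^ 2) ≤ W r := by
    intro r h h0
    have := expTrace_sub_smul_outer U (isSymmetric_add_smul_outer hH (r + h) a) a h0
    rw [expTrace_inf_orthogonal] at this
    have h2 : H + (r + h) • outer a + (-h) • outer a = H + r • outer a := by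
      rw [add_assoc, ← add_smul]
      simp
    rw [h2] at this
    simp only [hW]
    linarith
  have hlim : Filter.Tendsto (fun n : ℕ => W q * (1 + -(q * ‖a‖ ^ 2) / n) ^ n) Filter.atTop
      (nhds (W q * Real.exp (-(q * ‖a‖ ^ 2)))) :=
    (Real.tendsto_one_add_div_pow_exp _).const_mul _
  have hle : W q * Real.exp (-(q * ‖a‖ ^ 2)) ≤ W 0 := by
    refine le_of_tendsto hlim ?_
    filter_upwards [Filter.eventually_gt_atTop 0,
      Filter.eventually_ge_atTop ⌈q * ‖a‖ ^ 2⌉₊] with n hn0 hn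
    have hn0' : (0 : ℝ) < n := by exact_mod_cast hn0
    have hc : 0 ≤ 1 + -(q * ‖a‖ ^ 2) / n := by
      have : q * ‖a‖ ^ 2 / n ≤ 1 := (div_le_one hn0').2 (Nat.ceil_le.1 hn)
      rw [neg_div]
      linarith
    have : ∀ j : ℕ, W (j * (q / n)) * (1 + -(q * ‖a‖ ^ 2) / n) ^ j ≤ W 0 := by
      intro j
      induction j with
      | zero => simp
      | succ j ih =>
        refine le_trans ?_ ih
        have h3 := hstep (j * (q / n)) (q / n) (by positivity)
        have h4 : (1 - q / n * ‖a‖ ^ 2) = 1 + -(q * ‖a‖ ^ 2) / n := by ring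
        rw [h4] at h3
        have h5 : ((j + 1 : ℕ) : ℝ) * (q / n) = j * (q / n) + q / n := by push_cast; ring
        rw [h5, pow_succ', ← mul_assoc]
        exact mul_le_mul_of_nonneg_right h3 (pow_nonneg hc j)
    have h6 := this n
    rwa [mul_div_cancel₀ _ hn0'.ne'] at h6
  rw [← hW0]
  rw [Real.exp_neg] at hle
  have hp := Real.exp_pos (q * ‖a‖ ^ 2)
  calc W q = Real.exp (q * ‖a‖ ^ 2) * (W q * (Real.exp (q * ‖a‖ ^ 2))⁻¹) := by field_simp
    _ ≤ _ := by gcongr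

/-! ### Independent sampling and the supermartingale. -/

variable {ι : Type*} [DecidableEq ι]

/-- The probability of the sample `J` of `s`, if every `i ∈ s` is drawn independently with
probability `p i`. -/
def sampleWeight (p : ι → ℝ) (s J : Finset ι) : ℝ := (∏ i ∈ J, p i) * ∏ i ∈ s \ J, (1 - p i)

lemma sampleWeight_nonneg {p : ι → ℝ} {s J : Finset ι} (hJ : J ⊆ s)
    (h0 : ∀ i ∈ s, 0 ≤ p i) (h1 : ∀ i ∈ s, p i ≤ 1) : 0 ≤ sampleWeight p s J :=
  mul_nonneg (Finset.prod_nonneg fun i hi => h0 i (hJ hi))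
    (Finset.prod_nonneg fun i hi => sub_nonneg.2 (h1 i (Finset.mem_sdiff.1 hi).1))

lemma sum_sampleWeight (p : ι → ℝ) (s : Finset ι) : ∑ J ∈ s.powerset, sampleWeight p s J = 1 := by
  unfold sampleWeight
  rw [← Finset.prod_add]
  simp

lemma sampleWeight_insert_of_notMem (p : ι → ℝ) {s J : Finset ι} {i : ι} (hi : i ∉ s)
    (hJ : J ⊆ s) : sampleWeight p (insert i s) J = (1 - p i) * sampleWeight p s J := by
  have hiJ : i ∉ J := fun h => hi (hJ h)
  unfold sampleWeight
  rw [Finset.insert_sdiff_of_notMem _ hiJ, Finset.prod_insert (by simp [hi])]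
  ring

lemma sampleWeight_insert_insert (p : ι → ℝ) {s J : Finset ι} {i : ι} (hi : i ∉ s)
    (hJ : J ⊆ s) : sampleWeight p (insert i s) (insert i J) = p i * sampleWeight p s J := by
  have hiJ : i ∉ J := fun h => hi (hJ h)
  unfold sampleWeight
  rw [Finset.insert_sdiff_insert, Finset.prod_insert hiJ, Finset.sdiff_insert_of_notMem hi]
  ring

/-- The trace exponential on the orthogonal complement of the sampled vectors is a
supermartingale. -/
lemma sum_sampleWeight_expTrace_le (s : Finset ι) (a : ι → E) (p : ι → ℝ) {q : ℝ} (hq : 0 ≤ q)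
    (h0 : ∀ i ∈ s, 0 ≤ p i) (h1 : ∀ i ∈ s, p i ≤ 1)
    (hp : ∀ i ∈ s, 1 - p i ≤ Real.exp (-(q * ‖a i‖ ^ 2))) :
    ∀ (U : Submodule ℝ E) (H : E →ₗ[ℝ] E), H.IsSymmetric →
    ∑ J ∈ s.powerset, sampleWeight p s J *
      expTrace (U ⊓ J.inf fun i => (ℝ ∙ a i)ᗮ) (H + q • ∑ i ∈ s, outer (a i)) ≤
    expTrace U H := by
  induction s using Finset.induction_on with
  | empty =>
    intro U H hH
    simp [sampleWeight]
  | insert i s hi ih =>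
    intro U H hH
    have ih' := ih (fun j hj => h0 j (Finset.mem_insert_of_mem hj))
      (fun j hj => h1 j (Finset.mem_insert_of_mem hj))
      (fun j hj => hp j (Finset.mem_insert_of_mem hj))
    have hi0 := h0 i (Finset.mem_insert_self _ _)
    have hi1 := h1 i (Finset.mem_insert_self _ _)
    have hip := hp i (Finset.mem_insert_self _ _)
    have hH' := isSymmetric_add_smul_outer hH q (a i)
    -- Index `i` is treated first: not drawn, it leaves `U` unchanged; drawn, it cuts `U` down to
    -- the complement of `a i`, where the added term vanishes.
    have hA := ih' U _ hH'
    have hB := ih' (U ⊓ (ℝ ∙ a i)ᗮ) _ hH'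
    rw [expTrace_inf_orthogonal] at hB
    rw [Finset.sum_powerset_insert hi]
    have hop : H + q • ∑ j ∈ insert i s, outer (a j) =
        H + q • outer (a i) + q • ∑ j ∈ s, outer (a j) := by
      rw [Finset.sum_insert hi, smul_add, add_assoc]
    rw [hop]
    have e1 : ∑ J ∈ s.powerset, sampleWeight p (insert i s) J *
        expTrace (U ⊓ J.inf fun j => (ℝ ∙ a j)ᗮ)
          (H + q • outer (a i) + q • ∑ j ∈ s, outer (a j)) =
        (1 - p i) * ∑ J ∈ s.powerset, sampleWeight p s J *
          expTrace (U ⊓ J.inf fun j => (ℝ ∙ a j)ᗮ)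
          (H + q • outer (a i) + q • ∑ j ∈ s, outer (a j)) := by
      rw [Finset.mul_sum]
      refine Finset.sum_congr rfl fun J hJ => ?_
      rw [sampleWeight_insert_of_notMem p hi (Finset.mem_powerset.1 hJ), mul_assoc]
    have e2 : ∑ J ∈ s.powerset, sampleWeight p (insert i s) (insert i J) *
        expTrace (U ⊓ (insert i J).inf fun j => (ℝ ∙ a j)ᗮ)
          (H + q • outer (a i) + q • ∑ j ∈ s, outer (a j)) =
        p i * ∑ J ∈ s.powerset, sampleWeight p s J *
          expTrace (U ⊓ (ℝ ∙ a i)ᗮ ⊓ J.inf fun j => (ℝ ∙ a j)ᗮ)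
          (H + q • outer (a i) + q • ∑ j ∈ s, outer (a j)) := by
      rw [Finset.mul_sum]
      refine Finset.sum_congr rfl fun J hJ => ?_
      rw [sampleWeight_insert_insert p hi (Finset.mem_powerset.1 hJ), mul_assoc,
        Finset.inf_insert, inf_assoc]
    rw [e1, e2]
    have hadd := expTrace_add_smul_outer U hH (a i) hq
    have hW := sub_nonneg.2 (expTrace_inf_le U hH (a i))
    have hmul : (1 - p i) * Real.exp (q * ‖a i‖ ^ 2) ≤ 1 := by
      calc _ ≤ Real.exp (-(q * ‖a i‖ ^ 2)) * Real.exp (q * ‖a i‖ ^ 2) := by gcongr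
        _ = 1 := by rw [← Real.exp_add]; simp
    have h2 : (1 - p i) * (expTrace U (H + q • outer (a i)) - expTrace (U ⊓ (ℝ ∙ a i)ᗮ) H) ≤
        expTrace U H - expTrace (U ⊓ (ℝ ∙ a i)ᗮ) H := by
      calc _ ≤ (1 - p i) * (Real.exp (q * ‖a i‖ ^ 2) *
            (expTrace U H - expTrace (U ⊓ (ℝ ∙ a i)ᗮ) H)) :=
            mul_le_mul_of_nonneg_left hadd (by linarith)
        _ ≤ _ := by
            rw [← mul_assoc]
            exact mul_le_of_le_one_left hW hmul
    have h3 := mul_le_mul_of_nonneg_left hA (sub_nonneg.2 hi1)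
    have h4 := mul_le_mul_of_nonneg_left hB hi0
    linarith

/-- A sample drawn with probabilities proportional to squared lengths is unlikely to miss a
direction of large total energy. -/
theorem sum_sampleWeight_missed_le (s : Finset ι) (a : ι → E) (p : ι → ℝ) {q κ : ℝ} (hq : 0 ≤ q)
    (hκ : 0 < κ) (h0 : ∀ i ∈ s, 0 ≤ p i) (h1 : ∀ i ∈ s, p i ≤ 1)
    (hp : ∀ i ∈ s, 1 - p i ≤ Real.exp (-(q * ‖a i‖ ^ 2)))
    (bad : Finset (Finset ι)) (hbs : bad ⊆ s.powerset)
    (hb : ∀ J ∈ bad, ∃ w : E, w ≠ 0 ∧ (∀ i ∈ J, ⟪a i, w⟫_ℝ = 0) ∧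
      κ * ‖w‖ ^ 2 ≤ ∑ i ∈ s, ⟪a i, w⟫_ℝ ^ 2) :
    ∑ J ∈ bad, sampleWeight p s J ≤ s.card * Real.exp (-(q * κ)) := by
  classical
  -- Starting from the span, rather than all of `E`, bounds the initial trace by the number of
  -- vectors.
  set U : Submodule ℝ E := Submodule.span ℝ (s.image a : Finset E) with hU
  have hz : (0 : E →ₗ[ℝ] E).IsSymmetric := by intro; simp
  have hsm := sum_sampleWeight_expTrace_le s a p hq h0 h1 hp U 0 hz
  rw [expTrace_zero] at hsm
  have hfr : (Module.finrank ℝ U : ℝ) ≤ s.card := by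
    exact_mod_cast (finrank_span_finset_le_card (R := ℝ) (s.image a)).trans Finset.card_image_le
  have hsym := isSymmetric_add_smul_sum_outer hz q s a
  have hlow : ∀ J ∈ bad, Real.exp (q * κ) ≤
      expTrace (U ⊓ J.inf fun i => (ℝ ∙ a i)ᗮ) (0 + q • ∑ i ∈ s, outer (a i)) := by
    intro J hJ
    obtain ⟨w, hw0, hwJ, hw⟩ := hb J hJ
    have haU : ∀ i ∈ s, a i ∈ U := fun i hi =>
      Submodule.subset_span (by simpa using ⟨i, hi, rfl⟩)
    have hin : ∀ i ∈ s, ⟪a i, U.starProjection w⟫_ℝ = ⟪a i, w⟫_ℝ := by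
      intro i hi
      have := U.starProjection_inner_eq_zero w (a i) (haU i hi)
      rw [inner_sub_left, real_inner_comm, real_inner_comm (a i) (U.starProjection w)] at this
      linarith
    have hpos : 0 < ∑ i ∈ s, ⟪a i, w⟫_ℝ ^ 2 := by
      have : 0 < ‖w‖ := norm_pos_iff.2 hw0
      exact lt_of_lt_of_le (by positivity) hw
    -- Projecting `w` onto `U` keeps its inner products with the `a i` and does not lengthen it; its
    -- positive energy keeps the projection nonzero.
    refine exp_le_expTrace hsym (w := U.starProjection w) ?_ ?_ ?_
    · refine ⟨U.starProjection_apply_mem w, ?_⟩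
      have : ∀ i ∈ J, U.starProjection w ∈ (ℝ ∙ a i)ᗮ := fun i hi => by
        rw [Submodule.mem_orthogonal_singleton_iff_inner_right,
          hin i (Finset.mem_powerset.1 (hbs hJ) hi), hwJ i hi]
      simpa [Submodule.mem_finsetInf] using this
    · intro h
      rw [Finset.sum_congr rfl fun i hi => by rw [← hin i hi, h]] at hpos
      simp at hpos
    · have hform : ⟪U.starProjection w, (0 + q • ∑ i ∈ s, outer (a i)) (U.starProjection w)⟫_ℝ =
          q * ∑ i ∈ s, ⟪a i, w⟫_ℝ ^ 2 := by
        rw [zero_add, LinearMap.smul_apply, real_inner_smul_right, LinearMap.sum_apply, inner_sum]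
        congr 1
        refine Finset.sum_congr rfl fun i hi => ?_
        rw [inner_outer, hin i hi, sq]
      rw [hform, mul_assoc]
      refine mul_le_mul_of_nonneg_left (le_trans ?_ hw) hq
      gcongr
      exact U.norm_starProjection_apply_le w
  have hbd : (∑ J ∈ bad, sampleWeight p s J) * Real.exp (q * κ) ≤ s.card := by
    rw [Finset.sum_mul]
    refine le_trans ?_ (hsm.trans hfr)
    refine le_trans (Finset.sum_le_sum fun J hJ => mul_le_mul_of_nonneg_left (hlow J hJ)
      (sampleWeight_nonneg (Finset.mem_powerset.1 (hbs hJ)) h0 h1)) ?_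
    exact Finset.sum_le_sum_of_subset_of_nonneg hbs fun J hJ _ =>
      mul_nonneg (sampleWeight_nonneg (Finset.mem_powerset.1 hJ) h0 h1)
        (expTrace_nonneg _ hsym)
  rw [Real.exp_neg, ← div_eq_mul_inv, le_div_iff₀ (Real.exp_pos _)]
  exact hbd

end TraceExp

/-! ### Feature maps of kernels. -/

section Factor

open scoped MatrixOrder in
lemma exists_factor {n : Type*} [Fintype n] [DecidableEq n] {M : Matrix n n ℝ}
    (hM : M.PosSemidef) : ∃ F : Matrix n n ℝ, M = F.transpose * F := by
  obtain ⟨F, hF⟩ := CStarAlgebra.nonneg_iff_eq_star_mul_self.mp hM.nonneg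
  exact ⟨F, by rw [hF, Matrix.star_eq_conjTranspose, Matrix.conjTranspose_eq_transpose_of_trivial]⟩

lemma exists_feature {A : Type*} [Fintype A] [DecidableEq A] {k : A → A → ℝ}
    (hk : (Matrix.of k).PosSemidef) : ∃ φ : A → A → ℝ, ∀ a b, k a b = φ a ⬝ᵥ φ b := by
  obtain ⟨F, hF⟩ := exists_factor hk
  refine ⟨fun a i => F i a, fun a b => ?_⟩
  have := congrFun (congrFun hF a) b
  simpa [Matrix.mul_apply, dotProduct] using this

end Factor

/-! ### The square root of the pseudo-inverse. -/

section PseudoInverse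

variable {n : Type*} [Fintype n] [DecidableEq n]

lemma pinvSqrt_transpose (K : Matrix n n ℝ) : (pinvSqrt K).transpose = pinvSqrt K := by
  have h : IsSelfAdjoint (pinvSqrt K) := cfc_predicate _ _
  rw [← Matrix.conjTranspose_eq_transpose_of_trivial]
  exact h

-- The Penrose identity K K⁺ K = K, checked on the spectrum; at the eigenvalue 0 both sides vanish.
-- With the symmetry of `pinvSqrt K`, this is all that the projection property of the Nyström
-- embedding requires.
open scoped MatrixOrder in
lemma pinvSqrt_spec {K : Matrix n n ℝ} (hK : K.PosSemidef) :
    K * (pinvSqrt K * pinvSqrt K * K) = K := by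
  have hsa : IsSelfAdjoint K := hK.1
  have hid : cfc (fun v : ℝ => v) K = K := cfc_id' ℝ K
  have hcont : ∀ f : ℝ → ℝ, ContinuousOn f (spectrum ℝ K) := fun f =>
    (Matrix.finite_real_spectrum (A := K)).continuousOn f
  have hnn : ∀ v ∈ spectrum ℝ K, 0 ≤ v := fun v hv => spectrum_nonneg_of_nonneg hK.nonneg hv
  set f : ℝ → ℝ := fun v => (Real.sqrt v)⁻¹ with hf
  have hG : pinvSqrt K = cfc f K := rfl
  have h1 : cfc f K * cfc f K * K = cfc (fun v => f v * f v * v) K := by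
    rw [cfc_mul _ _ K (hcont _) (hcont _), cfc_mul f f K (hcont _) (hcont _), hid]
  rw [hG, h1]
  conv_lhs => enter [1]; rw [← hid]
  rw [← cfc_mul _ _ K (hcont _) (hcont _)]
  conv_rhs => rw [← hid]
  refine cfc_congr fun v hv => ?_
  rcases (hnn v hv).eq_or_lt with h0 | h0
  · simp [hf, ← h0]
  · have := Real.sqrt_pos.2 h0
    have h2 := Real.mul_self_sqrt (hnn v hv)
    simp only [hf]
    field_simp
    nlinarith

end PseudoInverse

/-! ### Values of inverse quadratic forms. -/

section Dual

variable {ι : Type*} [Fintype ι]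

/-- `s` is the value `fᵀ M⁻¹ f`, where `Q` is the quadratic form of `M`. -/
def IsDualValue (Q : (ι → ℝ) → ℝ) (f : ι → ℝ) (s : ℝ) : Prop :=
  (∃ u, f ⬝ᵥ u = s ∧ Q u = s) ∧ ∀ w, (f ⬝ᵥ w) ^ 2 ≤ s * Q w

/-- Inversion reverses the order of forms: Cauchy–Schwarz for `Q₁` at the vector attaining `s₂`
gives s₂² ≤ s₁ Q₁(u) ≤ s₁ β s₂. -/
lemma IsDualValue.le {Q₁ Q₂ : (ι → ℝ) → ℝ} {f : ι → ℝ} {s₁ s₂ β : ℝ}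
    (h₁ : IsDualValue Q₁ f s₁) (h₂ : IsDualValue Q₂ f s₂) (hQ₁ : ∀ u, 0 ≤ Q₁ u) (hβ : 0 ≤ β)
    (hQ : ∀ u, Q₁ u ≤ β * Q₂ u) : s₂ ≤ β * s₁ := by
  obtain ⟨⟨u₁, -, hu₁⟩, hw⟩ := h₁
  obtain ⟨⟨u, hfu, hu⟩, -⟩ := h₂
  have hs : 0 ≤ s₁ := hu₁ ▸ hQ₁ u₁
  have h := hw u
  rw [hfu] at h
  have h2 : s₂ ^ 2 ≤ s₁ * (β * s₂) := h.trans (mul_le_mul_of_nonneg_left (hu ▸ hQ u) hs)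
  by_contra hlt
  push Not at hlt
  have : 0 ≤ β * s₁ := by positivity
  nlinarith

lemma IsDualValue.nonneg {Q : (ι → ℝ) → ℝ} {f : ι → ℝ} {s : ℝ} (h : IsDualValue Q f s)
    (hQ : ∀ u, 0 ≤ Q u) : 0 ≤ s := by
  obtain ⟨⟨u, -, hu⟩, -⟩ := h
  exact hu ▸ hQ u

/-- The whitening map of a positive semidefinite matrix. -/
lemma exists_whitening [DecidableEq ι] {M : Matrix ι ι ℝ} (hM : M.PosSemidef) :
    ∃ W : (ι → ℝ) → EuclideanSpace ℝ ι, ∀ u v, inner ℝ (W u) (W v) = (M.mulVec u) ⬝ᵥ v := by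
  obtain ⟨F, rfl⟩ := exists_factor hM
  refine ⟨fun u => WithLp.toLp 2 (F.mulVec u), fun u v => ?_⟩
  rw [EuclideanSpace.inner_toLp_toLp, star_trivial, ← Matrix.mulVec_mulVec,
    Matrix.mulVec_transpose, ← Matrix.dotProduct_mulVec, dotProduct_comm]

lemma isDualValue_of_mulVec_eq [DecidableEq ι] {M : Matrix ι ι ℝ} (hM : M.PosSemidef)
    {f u : ι → ℝ} (h : M.mulVec u = f) :
    IsDualValue (fun w => M.mulVec w ⬝ᵥ w) f (f ⬝ᵥ u) := by
  obtain ⟨W, hW⟩ := exists_whitening hM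
  refine ⟨⟨u, rfl, by simp only [h]⟩, fun w => ?_⟩
  have := real_inner_mul_inner_self_le (W u) (W w)
  simp only [hW, h] at this
  rw [sq]
  exact this

end Dual

/-! ### Posterior variances and covering dictionaries in feature space. -/

section Features

variable {A ι : Type*} [Fintype ι] (φ : A → ι → ℝ) (x : ℕ → A)

lemma dotProduct_self_nonneg' (u : ι → ℝ) : 0 ≤ u ⬝ᵥ u := by
  simpa using dotProduct_star_self_nonneg u

/-- The energy `∑ₛ (φ(x_s)ᵀ u)²` of the first `t` candidates in the direction `u`. -/
def energy (t : ℕ) (u : ι → ℝ) : ℝ := ∑ s ∈ Finset.Icc 1 t, (φ (x s) ⬝ᵥ u) ^ 2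

/-- The feature matrix, with rows `φ(x_1), …, φ(x_t)`. -/
def featureMatrix (t : ℕ) : Matrix (Fin t) ι ℝ := Matrix.of fun i => φ (x (i + 1))

lemma energy_nonneg (t : ℕ) (u : ι → ℝ) : 0 ≤ energy φ x t u :=
  Finset.sum_nonneg fun _ _ => sq_nonneg _

lemma energy_mono {s t : ℕ} (h : s ≤ t) (u : ι → ℝ) : energy φ x s u ≤ energy φ x t u :=
  Finset.sum_le_sum_of_subset_of_nonneg (Finset.Icc_subset_Icc_right h) fun _ _ _ => sq_nonneg _

lemma featureMatrix_energy (t : ℕ) (u : ι → ℝ) :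
    (((featureMatrix φ x t).transpose * featureMatrix φ x t).mulVec u) ⬝ᵥ u = energy φ x t u := by
  rw [← Matrix.mulVec_mulVec, Matrix.mulVec_transpose, ← Matrix.dotProduct_mulVec]
  simp only [dotProduct, energy, featureMatrix, Matrix.mulVec, Matrix.of_apply]
  rw [Fin.sum_univ_eq_sum_range (fun i => (∑ j, φ (x (i + 1)) j * u j) *
    ∑ j, φ (x (i + 1)) j * u j), Finset.range_eq_Ico,
    Finset.sum_Ico_add' (fun i => (∑ j, φ (x i) j * u j) * ∑ j, φ (x i) j * u j)]
  exact Finset.sum_congr (by ext; simp) fun i _ => (sq _).symm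

/-- Up to `c λ`, the directions orthogonal to the candidates with index in `J` carry no energy. -/
def Covers (lam c : ℝ) (t : ℕ) (J : Finset ℕ) : Prop :=
  J ⊆ Finset.Icc 1 t ∧
    ∀ u : ι → ℝ, (∀ s ∈ J, φ (x s) ⬝ᵥ u = 0) → energy φ x t u ≤ c * lam * (u ⬝ᵥ u)

lemma posDef_transpose_mul_self_add {m n : Type*} [Fintype m] [Fintype n] [DecidableEq n]
    (B : Matrix m n ℝ) {lam : ℝ} (hlam : 0 < lam) :
    (B.transpose * B + lam • (1 : Matrix n n ℝ)).PosDef := by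
  have h1 : (B.transpose * B).PosSemidef := by
    rw [← Matrix.conjTranspose_eq_transpose_of_trivial]
    exact Matrix.posSemidef_conjTranspose_mul_self B
  exact Matrix.PosDef.posSemidef_add h1 (Matrix.PosDef.one.smul hlam)

lemma add_smul_one_mulVec {n : Type*} [Fintype n] [DecidableEq n] (M : Matrix n n ℝ) (lam : ℝ)
    (u : n → ℝ) : (M + lam • (1 : Matrix n n ℝ)).mulVec u = M.mulVec u + lam • u := by
  rw [Matrix.add_mulVec, Matrix.smul_mulVec, Matrix.one_mulVec]

lemma mulVec_inv_mulVec {n : Type*} [Fintype n] [DecidableEq n] {M : Matrix n n ℝ}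
    (hM : M.PosDef) (u : n → ℝ) : M.mulVec (M⁻¹.mulVec u) = u := by
  rw [Matrix.mulVec_mulVec, Matrix.mul_nonsing_inv _ (isUnit_iff_ne_zero.2 hM.det_pos.ne'),
    Matrix.one_mulVec]

lemma dotProduct_mulVec_transpose {m n : Type*} [Fintype m] [Fintype n] (M : Matrix m n ℝ)
    (u : m → ℝ) (v : n → ℝ) : u ⬝ᵥ M.mulVec v = M.transpose.mulVec u ⬝ᵥ v := by
  rw [Matrix.dotProduct_mulVec, Matrix.mulVec_transpose]

/-- The residual u - Pu is orthogonal to the dictionary and no longer than u, so covering bounds its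
energy. Young's inequality (p - r)² ≤ (1 + η)p² + (1 + 1/η)r² does the rest; η stays free because
its best value depends on the levels compared. -/
lemma energy_projection_le {φ : A → ι → ℝ} {x : ℕ → A} {P : Matrix ι ι ℝ}
    {t : ℕ} {J : Finset ℕ} {lam c η : ℝ} [DecidableEq ι]
    (hPt : P.transpose = P) (hPP : P * P = P) (hPJ : ∀ s ∈ J, P.mulVec (φ (x s)) = φ (x s))
    (hJ : Covers φ x lam c t J) (hη : 0 < η) (hc : 0 ≤ c * lam) (u : ι → ℝ) :
    energy φ x t (P.mulVec u) ≤
      (1 + η) * energy φ x t u + (1 + 1 / η) * (c * lam * (u ⬝ᵥ u)) := by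
  set w := u - P.mulVec u with hw
  have hPw : P.mulVec w = 0 := by
    rw [hw, Matrix.mulVec_sub, Matrix.mulVec_mulVec, hPP, sub_self]
  have hwJ : ∀ s ∈ J, φ (x s) ⬝ᵥ w = 0 := by
    intro s hs
    rw [← hPJ s hs, ← hPt, ← dotProduct_mulVec_transpose, hPw, dotProduct_zero]
  have hww : w ⬝ᵥ w ≤ u ⬝ᵥ u := by
    have h1 : P.mulVec u ⬝ᵥ w = 0 := by
      rw [← hPt, ← dotProduct_mulVec_transpose, hPw, dotProduct_zero]
    have h2 : u = P.mulVec u + w := by rw [hw]; abel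
    have h3 : u ⬝ᵥ u = P.mulVec u ⬝ᵥ P.mulVec u + w ⬝ᵥ w := by
      conv_lhs => rw [h2]
      rw [add_dotProduct, dotProduct_add, dotProduct_add, h1, dotProduct_comm w, h1]
      ring
    have : 0 ≤ P.mulVec u ⬝ᵥ P.mulVec u := by
      simpa using dotProduct_star_self_nonneg (P.mulVec u)
    linarith
  have hEw : energy φ x t w ≤ c * lam * (u ⬝ᵥ u) :=
    (hJ.2 w hwJ).trans (mul_le_mul_of_nonneg_left hww hc)
  have hsum : energy φ x t (P.mulVec u) ≤
      (1 + η) * energy φ x t u + (1 + 1 / η) * energy φ x t w := by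
    unfold energy
    rw [Finset.mul_sum, Finset.mul_sum, ← Finset.sum_add_distrib]
    refine Finset.sum_le_sum fun s _ => ?_
    have h4 : φ (x s) ⬝ᵥ P.mulVec u = φ (x s) ⬝ᵥ u - φ (x s) ⬝ᵥ w := by
      rw [← dotProduct_sub]
      congr 1
      rw [hw]
      abel
    rw [h4]
    set p := φ (x s) ⬝ᵥ u
    set r := φ (x s) ⬝ᵥ w
    have h5 : (1 + η) * p ^ 2 + (1 + 1 / η) * r ^ 2 - (p - r) ^ 2 = (η * p + r) ^ 2 / η := by
      field_simp
      ring
    have : 0 ≤ (η * p + r) ^ 2 / η := by positivity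
    linarith
  refine hsum.trans ?_
  gcongr

variable [DecidableEq ι] {φ} {k : A → A → ℝ} {lam : ℝ}

/-- The push-through identity: with (K_t + λI)g = Φφ(a), the vector λ⁻¹(φ(a) - Φᵀg) solves (ΦᵀΦ +
λI)u = φ(a), and its product with φ(a) is the kernel formula. -/
lemma exactSigma_isDualValue (hφ : ∀ a b, k a b = φ a ⬝ᵥ φ b)
    (hlam : 0 < lam) (t : ℕ) (a : A) :
    IsDualValue (fun u => energy φ x t u + lam * (u ⬝ᵥ u)) (φ a) (exactSigma k lam x t a ^ 2) := by
  set Φ := featureMatrix φ x t with hΦ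
  have hgram : gram k x t = Φ * Φ.transpose := by
    ext i j
    simp [gram, hΦ, featureMatrix, Matrix.mul_apply, hφ, dotProduct]
  have hkvec : kvec k x t a = Φ.mulVec (φ a) := by
    ext i
    simp [kvec, hΦ, featureMatrix, Matrix.mulVec, hφ]
  have hpos : (gram k x t + lam • (1 : Matrix (Fin t) (Fin t) ℝ)).PosDef := by
    have := posDef_transpose_mul_self_add Φ.transpose hlam
    rwa [Matrix.transpose_transpose, ← hgram] at this
  set g := (gram k x t + lam • 1)⁻¹.mulVec (kvec k x t a) with hg
  have hKg : Φ.mulVec (Φ.transpose.mulVec g) + lam • g = Φ.mulVec (φ a) := by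
    rw [Matrix.mulVec_mulVec, ← hgram, ← add_smul_one_mulVec, hg, mulVec_inv_mulVec hpos, hkvec]
  set u := lam⁻¹ • (φ a - Φ.transpose.mulVec g) with hu
  have hsolve : (Φ.transpose * Φ + lam • 1).mulVec u = φ a := by
    rw [add_smul_one_mulVec, ← Matrix.mulVec_mulVec, hu, smul_smul, mul_inv_cancel₀ hlam.ne',
      one_smul, Matrix.mulVec_smul, Matrix.mulVec_sub, ← hKg, add_sub_cancel_left,
      Matrix.mulVec_smul, Matrix.mulVec_smul, smul_smul, inv_mul_cancel₀ hlam.ne', one_smul]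
    abel
  have hdual := isDualValue_of_mulVec_eq (posDef_transpose_mul_self_add Φ hlam).posSemidef hsolve
  have hQ : (fun w => (Φ.transpose * Φ + lam • 1).mulVec w ⬝ᵥ w) =
      fun u => energy φ x t u + lam * (u ⬝ᵥ u) := by
    funext w
    rw [add_smul_one_mulVec, add_dotProduct, featureMatrix_energy, smul_dotProduct, smul_eq_mul]
  rw [hQ] at hdual
  have hval : exactSigma k lam x t a ^ 2 = φ a ⬝ᵥ u := by
    have h1 : (1 / lam) * (k a a - kvec k x t a ⬝ᵥ g) = φ a ⬝ᵥ u := by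
      rw [hu, dotProduct_smul, dotProduct_sub, hkvec, hφ, dotProduct_mulVec_transpose Φ.transpose,
        Matrix.transpose_transpose, one_div, smul_eq_mul]
    rw [exactSigma, ← hg, h1, Real.sq_sqrt]
    refine hdual.nonneg fun w => add_nonneg (energy_nonneg φ x t w) ?_
    exact mul_nonneg hlam.le (by simpa using dotProduct_star_self_nonneg w)
  rwa [hval]

lemma sum_Icc_add (f : ℕ → ℝ) {τ t : ℕ} (h : τ ≤ t) :
    ∑ s ∈ Finset.Icc 1 t, f s = ∑ s ∈ Finset.Icc 1 τ, f s + ∑ s ∈ Finset.Icc (τ + 1) t, f s := by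
  rw [← Finset.sum_union]
  · refine Finset.sum_congr ?_ fun _ _ => rfl
    ext s
    simp only [Finset.mem_union, Finset.mem_Icc]
    omega
  · refine Finset.disjoint_left.2 fun s h1 h2 => ?_
    simp only [Finset.mem_Icc] at h1 h2
    omega

/-- The dual value at time `τ` bounds each later (φ(x_s)·u)² by σ_τ(x_s)² times the form at `τ`.
Hence the form at `t` is at most 1 + Σσ_τ(x_s)² times the form at `τ`, and inversion reverses the
comparison. -/
lemma exactSigma_sq_le (hφ : ∀ a b, k a b = φ a ⬝ᵥ φ b) (hlam : 0 < lam) {τ t : ℕ} (h : τ ≤ t)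
    (a : A) : exactSigma k lam x τ a ^ 2 ≤
      (1 + ∑ s ∈ Finset.Icc (τ + 1) t, exactSigma k lam x τ (x s) ^ 2) *
        exactSigma k lam x t a ^ 2 := by
  refine IsDualValue.le (exactSigma_isDualValue x hφ hlam t a)
    (exactSigma_isDualValue x hφ hlam τ a) (fun u => ?_) (by positivity) fun u => ?_
  · exact add_nonneg (energy_nonneg φ x t u) (mul_nonneg hlam.le (dotProduct_self_nonneg' u))
  · have hQ : 0 ≤ energy φ x τ u + lam * (u ⬝ᵥ u) :=
      add_nonneg (energy_nonneg φ x τ u) (mul_nonneg hlam.le (dotProduct_self_nonneg' u))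
    have h1 : energy φ x t u = energy φ x τ u +
        ∑ s ∈ Finset.Icc (τ + 1) t, (φ (x s) ⬝ᵥ u) ^ 2 := sum_Icc_add _ h
    have h2 : ∑ s ∈ Finset.Icc (τ + 1) t, (φ (x s) ⬝ᵥ u) ^ 2 ≤
        (∑ s ∈ Finset.Icc (τ + 1) t, exactSigma k lam x τ (x s) ^ 2) *
          (energy φ x τ u + lam * (u ⬝ᵥ u)) := by
      rw [Finset.sum_mul]
      exact Finset.sum_le_sum fun s _ => (exactSigma_isDualValue x hφ hlam τ (x s)).2 u
    rw [h1]
    linarith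

variable [DecidableEq A]

/-- With F the matrix of dictionary features and Y = F K_S^{+/2}, the embedding is z(a) = Yᵀφ(a) and
P = YYᵀ. This moves the approximate variance from the dictionary's coordinates to a linear system in
feature space. -/
lemma exists_projection (hφ : ∀ a b, k a b = φ a ⬝ᵥ φ b) (hlam : 0 < lam)
    (S : Finset A) : ∃ P : Matrix ι ι ℝ,
    P.transpose = P ∧ P * P = P ∧ (∀ a ∈ S, P.mulVec (φ a) = φ a) ∧
    ∀ (x : ℕ → A) (t : ℕ) (a : A), ∃ u,
      (P * ((featureMatrix φ x t).transpose * featureMatrix φ x t) * P + lam • 1).mulVec u = φ a ∧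
        approxCov k lam x t S a a = φ a ⬝ᵥ u := by
  set Fs : Matrix ι S ℝ := Matrix.of fun i s => φ s i with hFs
  set K := dictKernel k S with hK
  have hKF : K = Fs.transpose * Fs := by
    ext s r
    simp [hK, dictKernel, hFs, Matrix.mul_apply, hφ, dotProduct]
  have hKpos : K.PosSemidef := by
    rw [hKF, ← Matrix.conjTranspose_eq_transpose_of_trivial]
    exact Matrix.posSemidef_conjTranspose_mul_self Fs
  set G := pinvSqrt K with hG
  have hGt : G.transpose = G := pinvSqrt_transpose K
  have hG2 := pinvSqrt_spec hKpos
  rw [← hG] at hG2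
  set Y := Fs * G with hY
  have hYt : Y.transpose = G * Fs.transpose := by rw [hY, Matrix.transpose_mul, hGt]
  set P := Y * Y.transpose with hP
  have hPFs : P * Fs = Fs := by
    -- FᵀF(GGK - 1) = K(GGK) - K = 0, and XᵀFᵀFX = 0 forces FX = 0.
    have h0 : P * Fs = Fs * (G * G * K) := by
      rw [hP, hYt, hY, hKF]
      simp only [Matrix.mul_assoc]
    rw [h0, ← sub_eq_zero]
    have h1 : Fs * (G * G * K) - Fs = Fs * (G * G * K - 1) := by
      rw [Matrix.mul_sub, Matrix.mul_one]
    rw [h1, ← Matrix.conjTranspose_mul_self_eq_zero, Matrix.conjTranspose_mul,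
      Matrix.conjTranspose_eq_transpose_of_trivial Fs, Matrix.mul_assoc, ← Matrix.mul_assoc _ Fs,
      ← hKF, Matrix.mul_sub, hG2, Matrix.mul_one, sub_self, Matrix.mul_zero]
  have hPY : P * Y = Y := by rw [hY, ← Matrix.mul_assoc, hPFs]
  have hPt : P.transpose = P := by rw [hP, Matrix.transpose_mul, Matrix.transpose_transpose]
  have hPP : P * P = P := by
    conv_lhs => rw [hP]
    rw [← Matrix.mul_assoc, ← hP, hPY]
  have hPY' : ∀ w, P.mulVec w = Y.mulVec (Y.transpose.mulVec w) := fun w => by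
    rw [hP, Matrix.mulVec_mulVec]
  clear_value P Y
  refine ⟨P, hPt, hPP, ?_, ?_⟩
  · intro a ha
    have : φ a = Fs.mulVec (Pi.single ⟨a, ha⟩ 1) := by
      ext i
      simp [hFs]
    rw [this, Matrix.mulVec_mulVec, hPFs]
  · intro x t a
    set Φ := featureMatrix φ x t with hΦ
    have hemb : ∀ b, embed k S b = Y.transpose.mulVec (φ b) := by
      intro b
      rw [hYt, ← Matrix.mulVec_mulVec]
      unfold embed
      rw [← hK, ← hG]
      congr 1
      ext s
      simp [hFs, Matrix.mulVec, dotProduct, hφ]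
    have hembM : embedMatrix k x t S = Φ * Y := by
      ext i s
      simp only [embedMatrix, Matrix.of_apply, hemb]
      simp [Matrix.mulVec, Matrix.mul_apply, hΦ, featureMatrix, dotProduct, mul_comm]
    have hV : V k lam x t S = (Φ * Y).transpose * (Φ * Y) + lam • 1 := by
      rw [V, hembM]
    set v := (V k lam x t S)⁻¹.mulVec (Y.transpose.mulVec (φ a)) with hv
    have hVv : Y.transpose.mulVec (Φ.transpose.mulVec (Φ.mulVec (Y.mulVec v))) + lam • v =
        Y.transpose.mulVec (φ a) := by
      have := mulVec_inv_mulVec (posDef_transpose_mul_self_add (Φ * Y) hlam)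
        (Y.transpose.mulVec (φ a))
      rw [← hV, ← hv, hV, add_smul_one_mulVec, Matrix.transpose_mul] at this
      simpa only [Matrix.mulVec_mulVec, Matrix.mul_assoc] using this
    -- On the kernel of `P` the system matrix is λI; on its range the system reduces to V v = z(a).
    refine ⟨lam⁻¹ • (φ a - P.mulVec (φ a)) + Y.mulVec v, ?_, ?_⟩
    · have hPu : P.mulVec (lam⁻¹ • (φ a - P.mulVec (φ a)) + Y.mulVec v) = Y.mulVec v := by
        rw [Matrix.mulVec_add, Matrix.mulVec_smul, Matrix.mulVec_sub, Matrix.mulVec_mulVec, hPP,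
          sub_self, smul_zero, zero_add, Matrix.mulVec_mulVec, hPY]
      rw [add_smul_one_mulVec, ← Matrix.mulVec_mulVec, ← Matrix.mulVec_mulVec, hPu,
        ← Matrix.mulVec_mulVec, hPY', eq_sub_of_add_eq hVv, hPY', smul_add, smul_smul,
        mul_inv_cancel₀ hlam.ne', one_smul,
        Matrix.mulVec_sub, Matrix.mulVec_smul]
      abel
    · rw [approxCov, hemb, ← hv, dotProduct_add, dotProduct_smul, dotProduct_sub, hφ,
        hPY', dotProduct_mulVec_transpose Y, dotProduct_mulVec_transpose Y,
        one_div, smul_eq_mul]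

/-- The approximate posterior variance is the dual value of the projected form. -/
lemma exists_projection_isDualValue (hφ : ∀ a b, k a b = φ a ⬝ᵥ φ b)
    (hlam : 0 < lam) (S : Finset A) : ∃ P : Matrix ι ι ℝ,
    P.transpose = P ∧ P * P = P ∧ (∀ a ∈ S, P.mulVec (φ a) = φ a) ∧
    ∀ (x : ℕ → A) (t : ℕ),
      (∀ a, IsDualValue (fun u => energy φ x t (P.mulVec u) + lam * (u ⬝ᵥ u)) (φ a)
        (approxSigma k lam x t S a ^ 2)) ∧
      ∃ (W : (ι → ℝ) → EuclideanSpace ℝ ι) (ψ : A → EuclideanSpace ℝ ι),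
        (∀ u, ‖W u‖ ^ 2 = energy φ x t (P.mulVec u) + lam * (u ⬝ᵥ u)) ∧
        (∀ a, ‖ψ a‖ ^ 2 = approxSigma k lam x t S a ^ 2) ∧
        ∀ a u, inner ℝ (ψ a) (W u) = φ a ⬝ᵥ u := by
  obtain ⟨P, hPt, hPP, hPS, h⟩ := exists_projection hφ hlam S
  refine ⟨P, hPt, hPP, hPS, fun x t => ?_⟩
  set Φ := featureMatrix φ x t with hΦ
  set M := P * (Φ.transpose * Φ) * P + lam • (1 : Matrix ι ι ℝ) with hM
  have hpos : M.PosSemidef := by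
    have := (posDef_transpose_mul_self_add (Φ * P) hlam).posSemidef
    rwa [Matrix.transpose_mul, hPt, show P * Φ.transpose * (Φ * P) =
      P * (Φ.transpose * Φ) * P by simp only [Matrix.mul_assoc]] at this
  have hQ : ∀ u, M.mulVec u ⬝ᵥ u = energy φ x t (P.mulVec u) + lam * (u ⬝ᵥ u) := by
    intro u
    rw [hM, add_smul_one_mulVec, add_dotProduct, smul_dotProduct, smul_eq_mul,
      ← featureMatrix_energy, ← hΦ, ← Matrix.mulVec_mulVec, ← Matrix.mulVec_mulVec,
      dotProduct_mulVec_transpose P, hPt]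
  choose v hv hval using h x t
  have hdual : ∀ a, IsDualValue (fun u => energy φ x t (P.mulVec u) + lam * (u ⬝ᵥ u)) (φ a)
      (φ a ⬝ᵥ v a) := fun a => by
    simpa only [hQ] using isDualValue_of_mulVec_eq hpos (hv a)
  have hsq : ∀ a, approxSigma k lam x t S a ^ 2 = φ a ⬝ᵥ v a := by
    intro a
    rw [approxSigma, hval, Real.sq_sqrt]
    refine (hdual a).nonneg fun w => add_nonneg (energy_nonneg φ x t _) ?_
    exact mul_nonneg hlam.le (by simpa using dotProduct_star_self_nonneg w)
  refine ⟨fun a => hsq a ▸ hdual a, ?_⟩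
  obtain ⟨W, hW⟩ := exists_whitening hpos
  refine ⟨W, fun a => W (v a), fun u => ?_, fun a => ?_, fun a u => ?_⟩
  · rw [← real_inner_self_eq_norm_sq, hW, hQ]
  · rw [← real_inner_self_eq_norm_sq, hW, hv, hsq]
  · rw [hW, hv]

/-- A covering dictionary gives approximate variances that are at most three times too small. -/
lemma exactSigma_sq_le_approxSigma_sq (hφ : ∀ a b, k a b = φ a ⬝ᵥ φ b) (hlam : 0 < lam) {τ : ℕ}
    {J : Finset ℕ} (hJ : Covers φ x lam (4 / 3) τ J) (a : A) :
    exactSigma k lam x τ a ^ 2 ≤ 3 * approxSigma k lam x τ (J.image x) a ^ 2 := by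
  obtain ⟨P, hPt, hPP, hPS, h⟩ := exists_projection_isDualValue hφ hlam (J.image x)
  refine IsDualValue.le ((h x τ).1 a) (exactSigma_isDualValue x hφ hlam τ a) (fun u => ?_)
    (by norm_num) fun u => ?_
  · exact add_nonneg (energy_nonneg φ x τ _) (mul_nonneg hlam.le (dotProduct_self_nonneg' u))
  -- With η = 2 the projected form is at most 3E + (3/2)(4/3)λ|u|² + λ|u|² = 3(E + λ|u|²).
  · have := energy_projection_le hPt hPP
      (fun s hs => hPS _ (Finset.mem_image_of_mem _ hs)) hJ two_pos (by positivity) u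
    linarith

/-- If the dictionary `J'` covers the candidates up to time `τ` at level `c'`, then a dictionary
sampled at time `t` by the resulting variances fails to cover at level `c` with small
probability. -/
lemma sum_sampleWeight_not_covers_le (hφ : ∀ a b, k a b = φ a ⬝ᵥ φ b) (hlam : 0 < lam) {τ t : ℕ}
    (hτ : τ ≤ t) {J' : Finset ℕ} {c' c η κ q : ℝ} (hJ' : Covers φ x lam c' τ J') (hc' : 0 ≤ c')
    (hc : 0 < c) (hη : 0 < η) (hκ : 0 < κ)
    (hκc : κ * ((1 + η) * c + (1 + 1 / η) * c' + 1) ≤ c) (hq : 0 ≤ q)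
    (bad : Finset (Finset ℕ)) (hbs : bad ⊆ (Finset.Icc 1 t).powerset)
    (hb : ∀ J ∈ bad, ¬ Covers φ x lam c t J) :
    ∑ J ∈ bad, sampleWeight (fun s => min 1 (q * approxSigma k lam x τ (J'.image x) (x s) ^ 2))
      (Finset.Icc 1 t) J ≤ t * Real.exp (-(q * κ)) := by
  obtain ⟨P, hPt, hPP, hPS, h⟩ := exists_projection_isDualValue hφ hlam (J'.image x)
  obtain ⟨-, W, ψ, hW, hψ, hψW⟩ := h x τ
  have hmain := sum_sampleWeight_missed_le (Finset.Icc 1 t) (fun s => ψ (x s))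
    (fun s => min 1 (q * approxSigma k lam x τ (J'.image x) (x s) ^ 2)) hq hκ
    (fun s _ => le_min zero_le_one (by positivity)) (fun s _ => min_le_left _ _) ?_ bad hbs ?_
  · simpa using hmain
  · intro s _
    rw [hψ]
    rcases min_cases 1 (q * approxSigma k lam x τ (J'.image x) (x s) ^ 2) with h1 | h1
    · rw [h1.1, sub_self]
      exact (Real.exp_pos _).le
    · rw [h1.1]
      have := Real.add_one_le_exp (-(q * approxSigma k lam x τ (J'.image x) (x s) ^ 2))
      linarith
  · intro J hJ
    have hn := hb J hJ
    simp only [Covers, Finset.mem_powerset.1 (hbs hJ), true_and, not_forall, not_le] at hn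
    obtain ⟨u, huJ, hu⟩ := hn
    have huu := dotProduct_self_nonneg' u
    have hproj := energy_projection_le hPt hPP
      (fun s hs => hPS _ (Finset.mem_image_of_mem _ hs)) hJ' hη (by positivity) u
    have hmono := energy_mono φ x hτ u
    have hupos : 0 < u ⬝ᵥ u := by
      refine lt_of_le_of_ne huu fun h0 => ?_
      have h1 : u = 0 := dotProduct_self_eq_zero.1 h0.symm
      rw [h1] at hu
      simp [energy] at hu
    have hQpos : 0 < ‖W u‖ ^ 2 := by
      rw [hW]
      have := energy_nonneg φ x τ (P.mulVec u)
      have := mul_pos hlam hupos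
      linarith
    refine ⟨W u, fun h0 => by simp [h0] at hQpos, fun s hs => by rw [hψW, huJ s hs], ?_⟩
    simp only [hψW]
    change _ ≤ energy φ x t u
    rw [hW]
    have hη' : 0 < 1 / η := by positivity
    have hEt := energy_nonneg φ x t u
    -- Here ‖W u‖² ≤ (1 + η)E + ((1 + 1/η)c' + 1)λ|u|², and the failure of covering allows cλ|u|² to
    -- be replaced by E.
    have h1 : c * (energy φ x τ (P.mulVec u) + lam * (u ⬝ᵥ u)) ≤
        ((1 + η) * c + (1 + 1 / η) * c' + 1) * energy φ x t u := by
      have e1 : c * energy φ x τ (P.mulVec u) ≤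
          c * ((1 + η) * energy φ x t u + (1 + 1 / η) * (c' * lam * (u ⬝ᵥ u))) := by
        refine mul_le_mul_of_nonneg_left (hproj.trans ?_) hc.le
        gcongr
      have e2 : ((1 + 1 / η) * c' + 1) * (c * lam * (u ⬝ᵥ u)) ≤
          ((1 + 1 / η) * c' + 1) * energy φ x t u :=
        mul_le_mul_of_nonneg_left hu.le (by positivity)
      nlinarith
    have h2 : κ * (c * (energy φ x τ (P.mulVec u) + lam * (u ⬝ᵥ u))) ≤ c * energy φ x t u := by
      calc _ ≤ κ * (((1 + η) * c + (1 + 1 / η) * c' + 1) * energy φ x t u) :=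
            mul_le_mul_of_nonneg_left h1 hκ.le
        _ = κ * ((1 + η) * c + (1 + 1 / η) * c' + 1) * energy φ x t u := by ring
        _ ≤ _ := mul_le_mul_of_nonneg_right hκc hEt
    have h3 : c * (κ * (energy φ x τ (P.mulVec u) + lam * (u ⬝ᵥ u))) ≤ c * energy φ x t u := by
      linarith
    exact le_of_mul_le_mul_left h3 hc

end Features

/-! ### Exponents, penalties and the summable series. -/

section Numerics

/-- The per-step budget `δ / (4 n)`. -/
def budget (δ : ℝ) (n : ℕ) : ℝ := δ / (4 * n)

variable {δ : ℝ} {n : ℕ}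

lemma budget_pos (hδ0 : 0 < δ) (hn : 1 ≤ n) : 0 < budget δ n := by
  have : (0 : ℝ) < n := by exact_mod_cast hn
  unfold budget
  positivity

lemma mul_budget (hn : 1 ≤ n) : n * budget δ n = δ / 4 := by
  have : (0 : ℝ) < n := by exact_mod_cast hn
  unfold budget
  field_simp

lemma exp_neg_mul_le_budget_rpow (hδ0 : 0 < δ) (hn : 1 ≤ n) {q e : ℝ}
    (he : 0 ≤ e) (hq : 8 * Real.log (4 * n / δ) ≤ q) :
    Real.exp (-(q * (e / 8))) ≤ budget δ n ^ e := by
  have hn' : (0 : ℝ) < n := by exact_mod_cast hn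
  rw [Real.rpow_def_of_pos (budget_pos hδ0 hn)]
  have : Real.log (budget δ n) = -Real.log (4 * n / δ) := by
    rw [← Real.log_inv, inv_div, budget]
  rw [this]
  refine Real.exp_le_exp.2 ?_
  nlinarith

lemma budget_rpow_le (hδ0 : 0 < δ) (hδ1 : δ < 1) (hn : 1 ≤ n) :
    budget δ n ^ (1 / 8 : ℝ) ≤ (n : ℝ) ^ (-(1 / 8) : ℝ) := by
  have hn' : (0 : ℝ) < n := by exact_mod_cast hn
  rw [Real.rpow_neg hn'.le, ← Real.inv_rpow hn'.le]
  refine Real.rpow_le_rpow (budget_pos hδ0 hn).le ?_ (by norm_num)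
  unfold budget
  rw [div_le_iff₀ (by positivity)]
  have : (n : ℝ)⁻¹ * (4 * n) = 4 := by field_simp
  linarith

/-- The weight of a batch that starts at step `n` with an inaccurate dictionary. -/
def penalty (δ : ℝ) (n : ℕ) : ℝ := 4 / 3 * (n * budget δ n ^ (67 / 40 : ℝ))

lemma penalty_nonneg (hδ0 : 0 < δ) : 0 ≤ penalty δ n := by
  have : 0 ≤ budget δ n := by unfold budget; positivity
  unfold penalty
  positivity

/-- One factor of the budget absorbs `n`, leaving a positive power of the budget. Thus the penalty
charged when a batch starts covers a failure at the later step that ends it. -/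
lemma penalty_anti (hδ0 : 0 < δ) {τ : ℕ} (hτ : 1 ≤ τ) (h : τ ≤ n) :
    penalty δ n ≤ penalty δ τ := by
  have key : ∀ j : ℕ, 1 ≤ j → penalty δ j = δ / 3 * budget δ j ^ (27 / 40 : ℝ) := by
    intro j hj
    have h1 : budget δ j ^ (67 / 40 : ℝ) = budget δ j * budget δ j ^ (27 / 40 : ℝ) := by
      rw [show (67 / 40 : ℝ) = 1 + 27 / 40 by norm_num, Real.rpow_add (budget_pos hδ0 hj),
        Real.rpow_one]
    rw [penalty, h1, ← mul_assoc (j : ℝ), mul_budget hj]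
    ring
  rw [key n (hτ.trans h), key τ hτ]
  have hτ' : (0 : ℝ) < τ := by exact_mod_cast hτ
  have hn' : (τ : ℝ) ≤ n := by exact_mod_cast h
  have hb : budget δ n ≤ budget δ τ := by
    unfold budget
    gcongr
  gcongr
  exact (budget_pos hδ0 (hτ.trans h)).le

/-- The two terms are the new charges at step `n`: failure from a strong dictionary, and the penalty
for a newly weak one. Both decay as n^{-9/8}, because 1 - 17/8 = 2 - (67/40 + 29/20) = -9/8. -/
lemma step_budget_le (hδ0 : 0 < δ) (hδ1 : δ < 1) (hn : 1 ≤ n) :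
    n * budget δ n ^ (17 / 8 : ℝ) + penalty δ n * (n * budget δ n ^ (29 / 20 : ℝ)) ≤
      δ / 12 * (n : ℝ) ^ (-(9 / 8) : ℝ) := by
  have hn' : (0 : ℝ) < n := by exact_mod_cast hn
  have hb := budget_pos hδ0 hn
  have h1 : budget δ n ^ (17 / 8 : ℝ) = budget δ n ^ 2 * budget δ n ^ (1 / 8 : ℝ) := by
    rw [show (17 / 8 : ℝ) = (2 : ℕ) + 1 / 8 by norm_num, Real.rpow_add hb, Real.rpow_natCast]
  have h2 : budget δ n ^ (67 / 40 : ℝ) * budget δ n ^ (29 / 20 : ℝ) =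
      budget δ n ^ 3 * budget δ n ^ (1 / 8 : ℝ) := by
    rw [← Real.rpow_add hb, show (67 / 40 + 29 / 20 : ℝ) = (3 : ℕ) + 1 / 8 by norm_num,
      Real.rpow_add hb, Real.rpow_natCast]
  have h3 : (n : ℝ) ^ (-(9 / 8) : ℝ) = (n : ℝ)⁻¹ * (n : ℝ) ^ (-(1 / 8) : ℝ) := by
    rw [show (-(9 / 8) : ℝ) = -1 + -(1 / 8) by norm_num, Real.rpow_add hn', Real.rpow_neg_one]
  have hle := budget_rpow_le hδ0 hδ1 hn
  have h4 : n * budget δ n ^ (17 / 8 : ℝ) + penalty δ n * (n * budget δ n ^ (29 / 20 : ℝ)) =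
      (δ ^ 2 / 16 + δ ^ 3 / 48) * ((n : ℝ)⁻¹ * budget δ n ^ (1 / 8 : ℝ)) := by
    calc _ = n * (budget δ n ^ 2 * budget δ n ^ (1 / 8 : ℝ)) + 4 / 3 * n ^ 2 *
          (budget δ n ^ (67 / 40 : ℝ) * budget δ n ^ (29 / 20 : ℝ)) := by
          rw [h1, penalty]
          ring
      _ = (n * budget δ n ^ 2 + 4 / 3 * n ^ 2 * budget δ n ^ 3) *
          budget δ n ^ (1 / 8 : ℝ) := by
          rw [h2]
          ring
      _ = _ := by
          rw [← mul_assoc]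
          congr 1
          unfold budget
          field_simp
          ring
  rw [h4, h3]
  have h5 : δ ^ 2 / 16 + δ ^ 3 / 48 ≤ δ / 12 := by
    have e1 : δ ^ 2 ≤ δ := by nlinarith
    have e2 : δ ^ 3 ≤ δ := by nlinarith
    linarith
  gcongr

/-- Integral comparison in telescoping form, from Bernoulli's inequality (1 - 1/y)^{1/8} ≤ 1 -
1/(8y) with y = n + 1. -/
lemma rpow_neg_step (hn : 1 ≤ n) :
    ((n + 1 : ℕ) : ℝ) ^ (-(9 / 8) : ℝ) ≤
      8 * ((n : ℝ) ^ (-(1 / 8) : ℝ) - ((n + 1 : ℕ) : ℝ) ^ (-(1 / 8) : ℝ)) := by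
  have hn' : (0 : ℝ) < n := by exact_mod_cast hn
  set y : ℝ := ((n + 1 : ℕ) : ℝ) with hy
  have hyn : y = n + 1 := by simp [hy]
  have hy0 : 0 < y := by linarith
  have h3 : y ^ (-(9 / 8) : ℝ) = y⁻¹ * y ^ (-(1 / 8) : ℝ) := by
    rw [show (-(9 / 8) : ℝ) = -1 + -(1 / 8) by norm_num, Real.rpow_add hy0, Real.rpow_neg_one]
  have hyi : y⁻¹ ≤ 1 := inv_le_one_of_one_le₀ (by linarith)
  have hyi0 : 0 < y⁻¹ := inv_pos.2 hy0
  have hbern : (1 + -y⁻¹) ^ (1 / 8 : ℝ) ≤ 1 + 1 / 8 * -y⁻¹ :=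
    rpow_one_add_le_one_add_mul_self (by linarith) (by norm_num) (by norm_num)
  have hfac : (n : ℝ) = y * (1 + -y⁻¹) := by
    have : y * y⁻¹ = 1 := mul_inv_cancel₀ hy0.ne'
    linarith [this]
  have hz0 : 0 < 1 + -y⁻¹ := by
    have : y⁻¹ < 1 := inv_lt_one_of_one_lt₀ (by linarith)
    linarith
  have hnpow : (n : ℝ) ^ (-(1 / 8) : ℝ) = y ^ (-(1 / 8) : ℝ) * (1 + -y⁻¹) ^ (-(1 / 8) : ℝ) := by
    rw [hfac, Real.mul_rpow hy0.le hz0.le]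
  have hinv : 1 + 1 / 8 * y⁻¹ ≤ (1 + -y⁻¹) ^ (-(1 / 8) : ℝ) := by
    rw [Real.rpow_neg hz0.le, le_inv_comm₀ (by positivity) (Real.rpow_pos_of_pos hz0 _)]
    refine hbern.trans ?_
    have h4 : (1 + 1 / 8 * -y⁻¹) * (1 + 1 / 8 * y⁻¹) ≤ 1 := by nlinarith
    simpa using (le_div_iff₀ (by positivity)).2 h4
  rw [h3, hnpow]
  have hp : 0 < y ^ (-(1 / 8) : ℝ) := Real.rpow_pos_of_pos hy0 _
  nlinarith

lemma sum_rpow_le (N : ℕ) (hN : 1 ≤ N) :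
    ∑ n ∈ Finset.range N, ((n + 1 : ℕ) : ℝ) ^ (-(9 / 8) : ℝ) ≤
      9 - 8 * (N : ℝ) ^ (-(1 / 8) : ℝ) := by
  induction N, hN using Nat.le_induction with
  | base => norm_num
  | succ N hN ih =>
    rw [Finset.sum_range_succ]
    have := rpow_neg_step hN
    linarith

end Numerics

/-! ### Measurability along a run and a single resampling. -/

section Run

variable {Ω A : Type*} {m : MeasurableSpace Ω} {μ : Measure Ω}
  {ℱ : Filtration ℕ m} {ι : Type*} [Fintype ι]
  {k : A → A → ℝ} {lam C : ℝ} {p T : ℕ} {q : ℕ → ℝ} {f : A → ℝ} {v : NNReal}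
  {R : Trajectory Ω A} {φ : A → ι → ℝ}

lemma Covers.congr {x x' : ℕ → A} {c : ℝ} {t : ℕ} {J : Finset ℕ}
    (h : ∀ s ∈ Finset.Icc 1 t, x s = x' s) (hc : Covers φ x lam c t J) :
    Covers φ x' lam c t J := by
  refine ⟨hc.1, fun u hu => ?_⟩
  have h1 : energy φ x' t u = energy φ x t u :=
    Finset.sum_congr rfl fun s hs => by rw [h s hs]
  rw [h1]
  exact hc.2 u fun s hs => by rw [h s (hc.1 hs), hu s hs]

/-- The observable state before the dictionary of step `t + 1` is sampled. -/
def state (R : Trajectory Ω A) (t : ℕ) (ω : Ω) : (Fin (t + 1) → A) × ℕ × Finset ℕ :=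
  (fun i => R.x (i + 1) ω, R.fb t ω, R.z (R.fb t ω) ω)

lemma state_path {t : ℕ} {ω ω' : Ω} (h : state R t ω = state R t ω') :
    ∀ s ∈ Finset.Icc 1 (t + 1), R.path ω s = R.path ω' s := by
  intro s hs
  rw [Finset.mem_Icc] at hs
  have := congrFun (congrArg Prod.fst h) ⟨s - 1, by omega⟩
  simpa [state, Trajectory.path, Nat.sub_add_cancel hs.1] using this

variable [DecidableEq A]

lemma fb_le (hR : R.IsRun μ ℱ k lam C p q f v T) {t : ℕ} (ht : t ≤ T) (ω : Ω) :
    R.fb t ω ≤ t := by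
  induction t with
  | zero => rw [hR.fb_zero]
  | succ t ih =>
    rw [hR.fb_succ t ht]
    split_ifs
    · exact (ih (by omega)).trans (by omega)
    · exact le_rfl

lemma fb_succ_eq_or (hR : R.IsRun μ ℱ k lam C p q f v T) {t : ℕ} (ht : t < T) (ω : Ω) :
    R.fb (t + 1) ω = t + 1 ∨ R.fb (t + 1) ω = R.fb t ω := by
  rw [hR.fb_succ t ht]
  split_ifs <;> simp

lemma measurableSet_resparsify (hR : R.IsRun μ ℱ k lam C p q f v T) {t : ℕ} (ht : t < T) :
    MeasurableSet[ℱ (t + 1)] {ω | R.fb (t + 1) ω = t + 1} :=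
  hR.measurable_fb (t + 1) ht (t + 1)

variable [Fintype A]

/-- The state has countably many values, so its fibres suffice. On a fibre `fb` is a constant j ≤ t,
whence the dictionary sampled at `j` is already known at `t + 1`. -/
lemma measurableSet_state (hR : R.IsRun μ ℱ k lam C p q f v T) {t : ℕ} (ht : t < T) {S : Set Ω}
    (hS : ∀ ω ω', state R t ω = state R t ω' → ω ∈ S → ω' ∈ S) : MeasurableSet[ℱ (t + 1)] S := by
  have hsing : ∀ h, MeasurableSet[ℱ (t + 1)] {ω | state R t ω = h} := by
    rintro ⟨a, j, J⟩
    by_cases hj : j ≤ t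
    · have : {ω | state R t ω = (a, j, J)} =
          (⋂ i : Fin (t + 1), {ω | R.x (i + 1) ω = a i}) ∩
            ({ω | R.fb t ω = j} ∩ {ω | R.z j ω = J}) := by
        ext ω
        simp only [state, Prod.mk.injEq, funext_iff, Set.mem_ofPred_eq, Set.mem_inter_iff,
          Set.mem_iInter]
        refine and_congr_right fun _ => and_congr_right fun h => by rw [h]
      rw [this]
      refine MeasurableSet.inter (MeasurableSet.iInter fun i => ?_) (MeasurableSet.inter ?_ ?_)
      · exact ℱ.mono (by omega) _ (hR.measurable_x i (by omega) (a i))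
      · exact ℱ.mono (by omega) _ (hR.measurable_fb t ht.le j)
      · exact ℱ.mono (by omega) _ (hR.measurable_z j (by omega) J)
    · have : {ω | state R t ω = (a, j, J)} = ∅ := by
        ext ω
        simp only [state, Prod.mk.injEq, Set.mem_ofPred_eq, Set.mem_empty_iff_false, iff_false]
        rintro ⟨-, h, -⟩
        exact hj (h ▸ fb_le hR ht.le ω)
      rw [this]
      exact @MeasurableSet.empty _ (ℱ (t + 1))
  have : S = ⋃ h ∈ state R t '' S, {ω | state R t ω = h} := by
    ext ω
    simp only [Set.mem_iUnion, Set.mem_ofPred_eq, exists_prop]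
    constructor
    · exact fun h => ⟨_, ⟨ω, h, rfl⟩, rfl⟩
    · rintro ⟨_, ⟨ω', h, rfl⟩, h'⟩
      exact hS _ _ h'.symm h
  rw [this]
  exact MeasurableSet.biUnion (Set.to_countable _) fun h _ => hsing h

/-- The dictionary in use after step `t` covers the candidates at level `c`. -/
def coverEvent (φ : A → ι → ℝ) (R : Trajectory Ω A) (lam c : ℝ) (t : ℕ) : Set Ω :=
  {ω | Covers φ (R.path ω) lam c (R.fb t ω) (R.z (R.fb t ω) ω)}

lemma measurableSet_coverEvent (hR : R.IsRun μ ℱ k lam C p q f v T) {t : ℕ} (ht : t < T)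
    (c : ℝ) : MeasurableSet[ℱ (t + 1)] (coverEvent φ R lam c t) := by
  refine measurableSet_state hR ht fun ω ω' h hω => ?_
  have h1 : R.fb t ω = R.fb t ω' := congrArg (fun h => h.2.1) h
  have h2 : R.z (R.fb t ω) ω = R.z (R.fb t ω') ω' := congrArg (fun h => h.2.2) h
  have hle := fb_le hR ht.le ω
  have := Covers.congr (fun s hs => state_path h s
    (Finset.Icc_subset_Icc_right (hle.trans (by omega)) hs)) hω
  rwa [h2, h1] at this

lemma measurableSet_covers (hR : R.IsRun μ ℱ k lam C p q f v T) {t : ℕ} (ht : t < T)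
    (c : ℝ) (J : Finset ℕ) :
    MeasurableSet[ℱ (t + 1)] {ω | Covers φ (R.path ω) lam c (t + 1) J} :=
  measurableSet_state hR ht fun _ _ h hω => Covers.congr (state_path h) hω

variable [IsProbabilityMeasure μ] [DecidableEq ι]

/-- Conditionally on a past with a covering dictionary, a resparsification step rarely ends with
a dictionary that does not cover. -/
lemma measure_not_cover_le (hR : R.IsRun μ ℱ k lam C p q f v T)
    (hφ : ∀ a b, k a b = φ a ⬝ᵥ φ b) (hlam : 0 < lam) {t : ℕ} (ht : t < T)
    {c c' η κ : ℝ} {G : Set Ω} (hG : MeasurableSet[ℱ (t + 1)] G)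
    (hGc : G ⊆ coverEvent φ R lam c' t) (hc' : 0 ≤ c') (hc : 0 < c) (hη : 0 < η) (hκ : 0 < κ)
    (hκc : κ * ((1 + η) * c + (1 + 1 / η) * c' + 1) ≤ c) (hq : 0 ≤ q (t + 1)) :
    μ.real ((G ∩ {ω | R.fb (t + 1) ω = t + 1}) \ coverEvent φ R lam c (t + 1)) ≤
      ((t + 1 : ℕ) * Real.exp (-(q (t + 1) * κ))) * μ.real (G ∩ {ω | R.fb (t + 1) ω = t + 1}) := by
  classical
  set r : Set Ω := {ω | R.fb (t + 1) ω = t + 1} with hr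
  set ε : ℝ := (t + 1 : ℕ) * Real.exp (-(q (t + 1) * κ)) with hε
  have hrm : MeasurableSet[ℱ (t + 1)] r := measurableSet_resparsify hR ht
  have hm := ℱ.le (t + 1)
  set N := (Finset.Icc 1 (t + 1)).powerset with hN
  -- For a fixed `J`, covering by `J` is determined by the past, so the conditional law of the
  -- sample can be integrated over `GJ J`.
  let GJ : Finset ℕ → Set Ω := fun J => G ∩ {ω | Covers φ (R.path ω) lam c (t + 1) J}
  let E : Finset ℕ → Set Ω := fun J => {ω | R.fb (t + 1) ω = t + 1 ∧ R.z (t + 1) ω = J}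
  let w : Finset ℕ → Ω → ℝ := fun J ω =>
    sampleWeight (R.inclusionProb k lam q t ω) (Finset.Icc 1 (t + 1)) J
  have hGJ : ∀ J, MeasurableSet[ℱ (t + 1)] (GJ J) := fun J =>
    hG.inter (measurableSet_covers hR ht c J)
  have hE : ∀ J, MeasurableSet (E J) := fun J =>
    (hm _ hrm).inter (ℱ.le _ _ (hR.measurable_z (t + 1) ht J))
  have hlaw : ∀ J ∈ N, μ[(E J).indicator (fun _ => (1 : ℝ)) | ℱ (t + 1)] =ᵐ[μ]
      r.indicator (w J) := fun J hJ => hR.law_z t ht J (Finset.mem_powerset.1 hJ)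
  have hint : ∀ J ∈ N, Integrable (r.indicator (w J)) μ := fun J hJ =>
    integrable_condExp.congr (hlaw J hJ)
  have hprob : ∀ J ∈ N, μ.real (GJ J ∩ E J) = ∫ ω, (GJ J).indicator (r.indicator (w J)) ω ∂μ := by
    intro J hJ
    rw [integral_indicator (hm _ (hGJ J)), ← setIntegral_congr_ae (g := r.indicator (w J))
      (hm _ (hGJ J)) ((hlaw J hJ).mono fun ω h _ => h), setIntegral_condExp hm
      ((integrable_const _).indicator (hE J)) (hGJ J), setIntegral_indicator (hE J)]
    simp
  -- The mass of the covering samples is bounded from below; the bad event then lies in what is left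
  -- of `G ∩ r`.
  have hsum : (1 - ε) * μ.real (G ∩ r) ≤ ∑ J ∈ N, μ.real (GJ J ∩ E J) := by
    rw [Finset.sum_congr rfl hprob, ← integral_finsetSum _ fun J hJ =>
      (hint J hJ).indicator (hm _ (hGJ J))]
    have hconst : (1 - ε) * μ.real (G ∩ r) = ∫ ω, (G ∩ r).indicator (fun _ => 1 - ε) ω ∂μ := by
      rw [integral_indicator (hm _ (hG.inter hrm))]
      simp [mul_comm]
    rw [hconst]
    refine integral_mono ((integrable_const _).indicator (hm _ (hG.inter hrm)))
      (integrable_finsetSum _ fun J hJ => (hint J hJ).indicator (hm _ (hGJ J))) fun ω => ?_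
    by_cases hω : ω ∈ G ∩ r
    · simp only [Set.indicator_of_mem hω]
      have hcov := hGc hω.1
      have hbad := sum_sampleWeight_not_covers_le (R.path ω) hφ hlam
        ((fb_le hR ht.le ω).trans (Nat.le_succ t)) hcov hc' hc hη hκ hκc hq
        (N.filter fun J => ¬ Covers φ (R.path ω) lam c (t + 1) J) (Finset.filter_subset _ _)
        (fun J hJ => (Finset.mem_filter.1 hJ).2)
      have htot := sum_sampleWeight (R.inclusionProb k lam q t ω) (Finset.Icc 1 (t + 1))
      rw [← hN, ← Finset.sum_filter_add_sum_filter_not N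
        (fun J => Covers φ (R.path ω) lam c (t + 1) J)] at htot
      have hgood : ∑ J ∈ N, (GJ J).indicator (r.indicator (w J)) ω =
          ∑ J ∈ N.filter (fun J => Covers φ (R.path ω) lam c (t + 1) J),
            sampleWeight (R.inclusionProb k lam q t ω) (Finset.Icc 1 (t + 1)) J := by
        rw [Finset.sum_filter]
        refine Finset.sum_congr rfl fun J _ => ?_
        by_cases hJ : Covers φ (R.path ω) lam c (t + 1) J
        · rw [if_pos hJ, Set.indicator_of_mem (show ω ∈ GJ J from ⟨hω.1, hJ⟩),
            Set.indicator_of_mem hω.2]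
        · rw [if_neg hJ, Set.indicator_of_notMem (fun h => hJ h.2)]
      rw [hgood]
      have hbad' : ∑ J ∈ N.filter (fun J => ¬ Covers φ (R.path ω) lam c (t + 1) J),
          sampleWeight (R.inclusionProb k lam q t ω) (Finset.Icc 1 (t + 1)) J ≤ ε := hbad
      linarith
    · simp only [Set.indicator_of_notMem hω]
      refine Finset.sum_nonneg fun J hJ => le_of_eq ?_
      by_cases hGω : ω ∈ GJ J
      · rw [Set.indicator_of_mem hGω, Set.indicator_of_notMem fun h => hω ⟨hGω.1, h⟩]
      · rw [Set.indicator_of_notMem hGω]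
  have hunion : μ.real (⋃ J ∈ N, GJ J ∩ E J) = ∑ J ∈ N, μ.real (GJ J ∩ E J) := by
    refine measureReal_biUnion_finset ?_ fun J _ => (hm _ (hGJ J)).inter (hE J)
    intro J _ J' _ hne
    refine Set.disjoint_left.2 fun ω h h' => hne ?_
    exact h.2.2.symm.trans h'.2.2
  have hmeas : MeasurableSet (⋃ J ∈ N, GJ J ∩ E J) :=
    Finset.measurableSet_biUnion _ fun J _ => (hm _ (hGJ J)).inter (hE J)
  have hdisj : Disjoint ((G ∩ r) \ coverEvent φ R lam c (t + 1)) (⋃ J ∈ N, GJ J ∩ E J) := by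
    refine Set.disjoint_left.2 fun ω h h' => h.2 ?_
    simp only [Set.mem_iUnion] at h'
    obtain ⟨J, -, hJ1, hJ2⟩ := h'
    change Covers φ (R.path ω) lam c (R.fb (t + 1) ω) (R.z (R.fb (t + 1) ω) ω)
    rw [hJ2.1, hJ2.2]
    exact hJ1.2
  have hsub : ((G ∩ r) \ coverEvent φ R lam c (t + 1)) ∪ (⋃ J ∈ N, GJ J ∩ E J) ⊆ G ∩ r := by
    refine Set.union_subset Set.sdiff_subset (Set.iUnion₂_subset fun J _ ω h => ?_)
    exact ⟨h.1.1, h.2.1⟩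
  have hle := measureReal_mono (μ := μ) hsub
  rw [measureReal_union hdisj hmeas (measure_ne_top _ _) (measure_ne_top _ _), hunion] at hle
  linarith

end Run

/-! ### Union over the horizon by a two-level potential. -/

section Potential

variable {Ω A : Type*} {m : MeasurableSpace Ω} {μ : Measure Ω}
  {ℱ : Filtration ℕ m} {ι : Type*} [Fintype ι]
  {k : A → A → ℝ} {lam C : ℝ} {p T : ℕ} {q : ℕ → ℝ} {f : A → ℝ} {v : NNReal}
  {R : Trajectory Ω A} {φ : A → ι → ℝ}

/-- All dictionaries up to step `t` cover the candidates at level `4 / 3`. -/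
def coverUpTo (φ : A → ι → ℝ) (R : Trajectory Ω A) (lam : ℝ) (t : ℕ) : Set Ω :=
  {ω | ∀ s ≤ t, ω ∈ coverEvent φ R lam (4 / 3) s}

/-- All dictionaries cover at level `4 / 3`, but the current one does not at level `2 / 3`. -/
def weakEvent (φ : A → ι → ℝ) (R : Trajectory Ω A) (lam : ℝ) (t : ℕ) : Set Ω :=
  coverUpTo φ R lam t \ coverEvent φ R lam (2 / 3) t

/-- The failure probability, plus the penalized probability of a weak dictionary. -/
def potential (φ : A → ι → ℝ) (R : Trajectory Ω A) {m : MeasurableSpace Ω} (μ : Measure Ω)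
    (lam δ : ℝ) (t : ℕ) : ℝ :=
  μ.real (coverUpTo φ R lam t)ᶜ +
    ∑ τ ∈ Finset.Icc 1 t, penalty δ τ * μ.real (weakEvent φ R lam t ∩ {ω | R.fb t ω = τ})

lemma coverEvent_congr {c : ℝ} {s t : ℕ} {ω : Ω} (h : R.fb s ω = R.fb t ω) :
    ω ∈ coverEvent φ R lam c s ↔ ω ∈ coverEvent φ R lam c t := by
  change Covers φ (R.path ω) lam c (R.fb s ω) (R.z (R.fb s ω) ω) ↔
    Covers φ (R.path ω) lam c (R.fb t ω) (R.z (R.fb t ω) ω)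
  rw [h]

lemma coverUpTo_succ {t : ℕ} {ω : Ω} : ω ∈ coverUpTo φ R lam (t + 1) ↔
    ω ∈ coverUpTo φ R lam t ∧ ω ∈ coverEvent φ R lam (4 / 3) (t + 1) := by
  constructor
  · exact fun h => ⟨fun s hs => h s (by omega), h _ le_rfl⟩
  · rintro ⟨h1, h2⟩ s hs
    rcases Nat.le_succ_iff.1 hs with h | h
    · exact h1 s h
    · exact h ▸ h2

variable [DecidableEq A]

lemma coverEvent_of_fb_eq_zero (hR : R.IsRun μ ℱ k lam C p q f v T) (hlam : 0 < lam) {c : ℝ}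
    (hc : 0 ≤ c) {t : ℕ} {ω : Ω} (h : R.fb t ω = 0) : ω ∈ coverEvent φ R lam c t := by
  change Covers φ (R.path ω) lam c (R.fb t ω) (R.z (R.fb t ω) ω)
  rw [h, hR.z_zero]
  refine ⟨by simp, fun u _ => ?_⟩
  have := dotProduct_self_nonneg' u
  simp only [energy, Finset.Icc_eq_empty_of_lt zero_lt_one, Finset.sum_empty]
  positivity

variable [Fintype A]

lemma measurableSet_coverUpTo (hR : R.IsRun μ ℱ k lam C p q f v T) {t : ℕ} (ht : t < T) :
    MeasurableSet[ℱ (t + 1)] (coverUpTo φ R lam t) := by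
  have : coverUpTo φ R lam t = ⋂ s ∈ Set.Iic t, coverEvent φ R lam (4 / 3) s := by
    ext ω
    simp [coverUpTo]
  rw [this]
  refine MeasurableSet.biInter (Set.to_countable _) fun s hs => ?_
  have hs' : s ≤ t := hs
  exact ℱ.mono (by omega) _ (measurableSet_coverEvent hR (by omega) _)

variable [IsProbabilityMeasure μ] [DecidableEq ι]

/-- When a batch with a weak dictionary ends at step `n`, its penalty is released: three quarters
pay for failure, one quarter for being weak again. Only transitions from level 2/3 add to the
potential. -/
lemma potential_succ_le (hR : R.IsRun μ ℱ k lam C p q f v T)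
    (hφ : ∀ a b, k a b = φ a ⬝ᵥ φ b) (hlam : 0 < lam) {δ : ℝ} (hδ0 : 0 < δ) (hδ1 : δ < 1)
    (hq : ∀ t, 1 ≤ t → t ≤ T → 8 * Real.log (4 * t / δ) ≤ q t) {t : ℕ} (ht : t < T) :
    potential φ R μ lam δ (t + 1) ≤
      potential φ R μ lam δ t + δ / 12 * ((t + 1 : ℕ) : ℝ) ^ (-(9 / 8) : ℝ) := by
  set n := t + 1 with hn
  have hn1 : 1 ≤ n := by omega
  have hqn := hq n hn1 ht
  have hq0 : 0 ≤ q n := by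
    refine le_trans ?_ hqn
    have : (1 : ℝ) ≤ n := by exact_mod_cast hn1
    have : 1 ≤ 4 * (n : ℝ) / δ := by
      rw [le_div_iff₀ hδ0]
      linarith
    have := Real.log_nonneg this
    linarith
  set r : Set Ω := {ω | R.fb n ω = n} with hr
  have hrm : MeasurableSet r := ℱ.le _ _ (measurableSet_resparsify hR ht)
  set D := coverUpTo φ R lam t with hD
  set Y := weakEvent φ R lam t with hY
  set X := D ∩ coverEvent φ R lam (2 / 3) t with hX
  have hDm := measurableSet_coverUpTo (φ := φ) hR ht
  have hcm := measurableSet_coverEvent (φ := φ) hR ht (2 / 3)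
  have hXm : MeasurableSet[ℱ (t + 1)] X := hDm.inter hcm
  have hYm : MeasurableSet[ℱ (t + 1)] Y := hDm.diff hcm
  have hXc : X ⊆ coverEvent φ R lam (2 / 3) t := Set.inter_subset_right
  have hYc : Y ⊆ coverEvent φ R lam (4 / 3) t := fun ω h => h.1 t le_rfl
  have hn0 : (0 : ℝ) ≤ n := Nat.cast_nonneg n
  have hexp : ∀ e : ℝ, 0 ≤ e → Real.exp (-(q n * (e / 8))) ≤ budget δ n ^ e := fun e he =>
    exp_neg_mul_le_budget_rpow hδ0 hn1 he hqn
  have hbound : ∀ {c c' η e : ℝ} {G : Set Ω}, MeasurableSet[ℱ (t + 1)] G →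
      G ⊆ coverEvent φ R lam c' t → 0 ≤ c' → 0 < c → 0 < η → 0 < e →
      e / 8 * ((1 + η) * c + (1 + 1 / η) * c' + 1) ≤ c →
      μ.real ((G ∩ r) \ coverEvent φ R lam c n) ≤ n * budget δ n ^ e * μ.real (G ∩ r) := by
    intro c c' η e G hG hGc hc' hc hη he hec
    refine (measure_not_cover_le hR hφ hlam ht hG hGc hc' hc hη (by positivity) hec hq0).trans ?_
    exact mul_le_mul_of_nonneg_right (mul_le_mul_of_nonneg_left (hexp e he.le) hn0)
      measureReal_nonneg
  have hX1 : μ.real (X ∩ r) ≤ 1 := measureReal_le_one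
  have hbp := budget_pos hδ0 hn1
  -- In `w1` to `w4`, η is close to the minimizer √(c'/c) of (1 + η)c + (1 + 1/η)c', and the
  -- exponent e satisfies e ≤ 8c / ((1 + η)c + (1 + 1/η)c' + 1).
  have w1 : μ.real ((X ∩ r) \ coverEvent φ R lam (4 / 3) n) ≤
      n * budget δ n ^ (17 / 8 : ℝ) :=
    (hbound (η := 7 / 10) hXm hXc (by norm_num) (by norm_num) (by norm_num) (by norm_num)
      (by norm_num)).trans (mul_le_of_le_one_right (by positivity) hX1)
  have w2 : μ.real ((X ∩ r) \ coverEvent φ R lam (2 / 3) n) ≤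
      n * budget δ n ^ (29 / 20 : ℝ) :=
    (hbound (η := 1) hXm hXc (by norm_num) (by norm_num) (by norm_num) (by norm_num)
      (by norm_num)).trans (mul_le_of_le_one_right (by positivity) hX1)
  have w3 : μ.real ((Y ∩ r) \ coverEvent φ R lam (2 / 3) n) ≤ 1 / 4 * μ.real (Y ∩ r) := by
    refine (hbound (η := 7 / 5) (e := 1) hYm hYc (by norm_num) (by norm_num) (by norm_num)
      (by norm_num) (by norm_num)).trans ?_
    rw [Real.rpow_one, mul_budget hn1]
    gcongr
  have w4 : μ.real ((Y ∩ r) \ coverEvent φ R lam (4 / 3) n) ≤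
      3 / 4 * penalty δ n * μ.real (Y ∩ r) := by
    refine (hbound (η := 1) (e := 67 / 40) hYm hYc (by norm_num) (by norm_num) (by norm_num)
      (by norm_num) (by norm_num)).trans (le_of_eq ?_)
    rw [penalty]
    ring
  have hfb : ∀ ω, ω ∉ r → R.fb n ω = R.fb t ω := fun ω h =>
    (fb_succ_eq_or hR ht ω).resolve_left h
  have hfail : μ.real (coverUpTo φ R lam n)ᶜ ≤ μ.real Dᶜ +
      (μ.real ((X ∩ r) \ coverEvent φ R lam (4 / 3) n) +
        μ.real ((Y ∩ r) \ coverEvent φ R lam (4 / 3) n)) := by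
    refine le_trans (measureReal_mono ?_) ((measureReal_union_le (μ := μ) _ _).trans
      (add_le_add_right (measureReal_union_le _ _) _))
    intro ω hω
    by_cases hωD : ω ∈ D
    · right
      have hωn : ω ∉ coverEvent φ R lam (4 / 3) n := fun h => hω (coverUpTo_succ.2 ⟨hωD, h⟩)
      have hωr : ω ∈ r := by
        by_contra h
        exact hωn ((coverEvent_congr (hfb ω h)).2 (hωD t le_rfl))
      by_cases h : ω ∈ coverEvent φ R lam (2 / 3) t
      · exact Or.inl ⟨⟨⟨hωD, h⟩, hωr⟩, hωn⟩
      · exact Or.inr ⟨⟨⟨hωD, h⟩, hωr⟩, hωn⟩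
    · exact Or.inl hωD
  have hweak_new : μ.real (weakEvent φ R lam n ∩ {ω | R.fb n ω = n}) ≤
      μ.real ((X ∩ r) \ coverEvent φ R lam (2 / 3) n) +
        μ.real ((Y ∩ r) \ coverEvent φ R lam (2 / 3) n) := by
    refine le_trans (measureReal_mono ?_) (measureReal_union_le (μ := μ) _ _)
    rintro ω ⟨⟨h1, h2⟩, h3⟩
    have hωD := (coverUpTo_succ.1 h1).1
    by_cases h : ω ∈ coverEvent φ R lam (2 / 3) t
    · exact Or.inl ⟨⟨⟨hωD, h⟩, h3⟩, h2⟩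
    · exact Or.inr ⟨⟨⟨hωD, h⟩, h3⟩, h2⟩
  have hweak_old : ∀ τ ∈ Finset.Icc 1 t,
      penalty δ τ * μ.real (weakEvent φ R lam n ∩ {ω | R.fb n ω = τ}) +
        penalty δ n * μ.real (Y ∩ {ω | R.fb t ω = τ} ∩ r) ≤
      penalty δ τ * μ.real (Y ∩ {ω | R.fb t ω = τ}) := by
    intro τ hτ
    rw [Finset.mem_Icc] at hτ
    have hsplit := measureReal_inter_add_sdiff (μ := μ) (s := Y ∩ {ω | R.fb t ω = τ}) hrm
    have hsub : μ.real (weakEvent φ R lam n ∩ {ω | R.fb n ω = τ}) ≤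
        μ.real ((Y ∩ {ω | R.fb t ω = τ}) \ r) := by
      refine measureReal_mono ?_
      rintro ω ⟨⟨h1, h2⟩, h3⟩
      have h3' : R.fb n ω = τ := h3
      have hωr : ω ∉ r := fun h => by
        have h' : R.fb n ω = n := h
        omega
      refine ⟨⟨⟨(coverUpTo_succ.1 h1).1, fun h => h2 ((coverEvent_congr (hfb ω hωr)).2 h)⟩, ?_⟩,
        hωr⟩
      exact (hfb ω hωr).symm.trans h3'
    have hanti := penalty_anti hδ0 hτ.1 (show τ ≤ n by omega)
    have hpτ : 0 ≤ penalty δ τ := penalty_nonneg hδ0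
    have e1 := mul_le_mul_of_nonneg_left hsub hpτ
    have e2 := mul_le_mul_of_nonneg_right hanti
      (measureReal_nonneg (μ := μ) (s := Y ∩ {ω | R.fb t ω = τ} ∩ r))
    rw [← hsplit]
    linarith
  -- The sum may start at τ = 1: with no candidates there is no energy, so the initial dictionary is
  -- never weak.
  have hYr : μ.real (Y ∩ r) ≤ ∑ τ ∈ Finset.Icc 1 t, μ.real (Y ∩ {ω | R.fb t ω = τ} ∩ r) := by
    refine le_trans (measureReal_mono ?_ (measure_ne_top _ _)) (measureReal_biUnion_finset_le _ _)
    rintro ω ⟨h1, h2⟩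
    have h3 : R.fb t ω ≠ 0 := fun h =>
      h1.2 (coverEvent_of_fb_eq_zero hR hlam (by norm_num) h)
    simp only [Set.mem_iUnion]
    exact ⟨R.fb t ω, Finset.mem_Icc.2 ⟨by omega, fb_le hR ht.le ω⟩, ⟨h1, rfl⟩, h2⟩
  have hpn : 0 ≤ penalty δ n := penalty_nonneg hδ0
  have hsum := Finset.sum_le_sum hweak_old
  rw [Finset.sum_add_distrib, ← Finset.mul_sum] at hsum
  have hYr' := mul_le_mul_of_nonneg_left hYr hpn
  have hnew' := mul_le_mul_of_nonneg_left (hweak_new.trans (add_le_add w2 w3)) hpn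
  have hstep := step_budget_le hδ0 hδ1 hn1
  unfold potential
  rw [Finset.sum_Icc_succ_top (show 1 ≤ t + 1 by omega)]
  simp only [← hn, ← hD, ← hY]
  linarith

lemma measure_coverUpTo (hR : R.IsRun μ ℱ k lam C p q f v T)
    (hφ : ∀ a b, k a b = φ a ⬝ᵥ φ b) (hlam : 0 < lam) {δ : ℝ} (hδ0 : 0 < δ) (hδ1 : δ < 1)
    (hq : ∀ t, 1 ≤ t → t ≤ T → 8 * Real.log (4 * t / δ) ≤ q t) :
    1 - δ ≤ μ.real (coverUpTo φ R lam T) := by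
  have hpot : ∀ t ≤ T, potential φ R μ lam δ t ≤
      δ / 12 * ∑ n ∈ Finset.range t, ((n + 1 : ℕ) : ℝ) ^ (-(9 / 8) : ℝ) := by
    intro t ht
    induction t with
    | zero =>
      have : coverUpTo φ R lam 0 = Set.univ := by
        refine Set.eq_univ_of_forall fun ω s hs => ?_
        obtain rfl : s = 0 := by omega
        exact coverEvent_of_fb_eq_zero hR hlam (by norm_num) (hR.fb_zero ω)
      simp [potential, this]
    | succ t ih =>
      have h1 := ih (by omega)
      have h2 := potential_succ_le hR hφ hlam hδ0 hδ1 hq (show t < T by omega)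
      rw [Finset.sum_range_succ, mul_add]
      linarith
  have hsum : ∑ n ∈ Finset.range T, ((n + 1 : ℕ) : ℝ) ^ (-(9 / 8) : ℝ) ≤ 9 := by
    rcases Nat.eq_zero_or_pos T with h | h
    · simp [h]
    · have := sum_rpow_le T h
      have : 0 ≤ (T : ℝ) ^ (-(1 / 8) : ℝ) := by positivity
      linarith
  -- The increments add up to at most 9δ/12.
  have hfail : μ.real (coverUpTo φ R lam T)ᶜ ≤ δ := by
    have h1 : μ.real (coverUpTo φ R lam T)ᶜ ≤ potential φ R μ lam δ T :=
      le_add_of_nonneg_right (Finset.sum_nonneg fun τ _ =>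
        mul_nonneg (penalty_nonneg hδ0) measureReal_nonneg)
    have h2 := hpot T le_rfl
    nlinarith
  have hun := measureReal_union_le (μ := μ) (coverUpTo φ R lam T) (coverUpTo φ R lam T)ᶜ
  rw [Set.union_compl_self, probReal_univ] at hun
  linarith

end Potential

/-! ### The ratio bound on a covered path. -/

section Deterministic

lemma exactRatio_pow_le {A ι : Type*} [Fintype ι] [DecidableEq ι] [DecidableEq A]
    {φ : A → ι → ℝ} {k : A → A → ℝ} {lam : ℝ} (x : ℕ → A)
    (hφ : ∀ a b, k a b = φ a ⬝ᵥ φ b) (hlam : 0 < lam) {τ t : ℕ} (hτ : τ ≤ t) {J : Finset ℕ}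
    (hJ : Covers φ x lam (4 / 3) τ J) (a : A) {j : ℕ} (hj : j = 1 ∨ j = 2) :
    exactRatio k lam x τ t a ^ j ≤
      3 * (1 + ∑ s ∈ Finset.Icc (τ + 1) t, approxSigma k lam x τ (J.image x) (x s) ^ j) := by
  set b : ℕ → ℝ := fun s => approxSigma k lam x τ (J.image x) (x s) with hb
  have hb0 : ∀ s, 0 ≤ b s := fun s => Real.sqrt_nonneg _
  have hratio0 : 0 ≤ exactRatio k lam x τ t a :=
    div_nonneg (Real.sqrt_nonneg _) (Real.sqrt_nonneg _)
  have hsq : exactRatio k lam x τ t a ^ 2 ≤ 1 + 3 * ∑ s ∈ Finset.Icc (τ + 1) t, b s ^ 2 := by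
    have h1 : exactRatio k lam x τ t a ^ 2 ≤
        1 + ∑ s ∈ Finset.Icc (τ + 1) t, exactSigma k lam x τ (x s) ^ 2 := by
      rw [exactRatio, div_pow]
      exact div_le_of_le_mul₀ (sq_nonneg _) (by positivity) (exactSigma_sq_le x hφ hlam hτ a)
    have h2 : ∑ s ∈ Finset.Icc (τ + 1) t, exactSigma k lam x τ (x s) ^ 2 ≤
        3 * ∑ s ∈ Finset.Icc (τ + 1) t, b s ^ 2 := by
      rw [Finset.mul_sum]
      exact Finset.sum_le_sum fun s _ => exactSigma_sq_le_approxSigma_sq x hφ hlam hJ (x s)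
    linarith
  rcases hj with rfl | rfl
  · simp only [pow_one]
    have hS : 0 ≤ ∑ s ∈ Finset.Icc (τ + 1) t, b s := Finset.sum_nonneg fun s _ => hb0 s
    have h3 : ∑ s ∈ Finset.Icc (τ + 1) t, b s ^ 2 ≤ (∑ s ∈ Finset.Icc (τ + 1) t, b s) ^ 2 :=
      Finset.sum_sq_le_sq_sum_of_nonneg fun s _ => hb0 s
    -- With S = Σ b_s ≥ 0, the squared ratio is at most 1 + 3S² ≤ (3(1 + S))².
    refine (sq_le_sq₀ hratio0 (by positivity)).1 ?_
    nlinarith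
  · linarith

end Deterministic

end BBKB

end

theorem mainTheorem6 {Ω A : Type*} {m : MeasurableSpace Ω} (μ : Measure Ω)
    [IsProbabilityMeasure μ] (ℱ : Filtration ℕ m) [Fintype A] [DecidableEq A]
    (k : A → A → ℝ) (hk : (Matrix.of k).PosSemidef)
    (δ lam C : ℝ) (hδ0 : 0 < δ) (hδ1 : δ < 1) (hlam : 1 ≤ lam) (hC : 1 ≤ C)
    (p : ℕ) (hp : p = 1 ∨ p = 2) (T : ℕ)
    (q : ℕ → ℝ) (hq : ∀ t, 1 ≤ t → t ≤ T → 8 * Real.log (4 * t / δ) ≤ q t)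
    (f : A → ℝ) (v : NNReal)
    (R : BBKB.Trajectory Ω A) (hR : R.IsRun μ ℱ k lam C p q f v T) :
    1 - δ ≤ μ.real {ω | ∀ t ≤ T, ∀ a : A,
      (∀ j : ℕ, j = 1 ∨ j = 2 →
        BBKB.exactRatio k lam (R.path ω) (R.fb t ω) t a ^ j ≤
          3 * (1 + ∑ s ∈ Finset.Icc (R.fb t ω + 1) t, R.batchSigma k lam t ω (R.x s ω) ^ j)) ∧
      BBKB.exactRatio k lam (R.path ω) (R.fb t ω) t a ^ p ≤ 3 * C} := by
  obtain ⟨φ, hφ⟩ := BBKB.exists_feature hk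
  have hlam0 : 0 < lam := by linarith
  refine (BBKB.measure_coverUpTo hR hφ hlam0 hδ0 hδ1 hq).trans (measureReal_mono ?_)
  intro ω hω t ht a
  have hmain : ∀ j : ℕ, j = 1 ∨ j = 2 →
      BBKB.exactRatio k lam (R.path ω) (R.fb t ω) t a ^ j ≤
        3 * (1 + ∑ s ∈ Finset.Icc (R.fb t ω + 1) t, R.batchSigma k lam t ω (R.x s ω) ^ j) :=
    fun j hj => BBKB.exactRatio_pow_le (R.path ω) hφ hlam0 (BBKB.fb_le hR ht ω) (hω t ht) a hj
  refine ⟨hmain, (hmain p hp).trans ?_⟩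
  suffices h : 1 + ∑ s ∈ Finset.Icc (R.fb t ω + 1) t, R.batchSigma k lam t ω (R.x s ω) ^ p ≤ C by
    linarith
  -- If `t` starts the batch, the sum is empty and 1 ≤ C suffices. Otherwise step `t` did not
  -- resparsify, so its termination test passed, and that test used the same dictionary and standard
  -- deviations.
  rcases (BBKB.fb_le hR ht ω).eq_or_lt with h | h
  · simpa [h] using hC
  · obtain ⟨t, rfl⟩ : ∃ s, t = s + 1 := ⟨t - 1, by omega⟩
    have hs := hR.fb_succ t ht ω
    split_ifs at hs with hcond
    · have : R.batchSigma k lam (t + 1) ω = R.batchSigma k lam t ω := by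
        funext b
        simp only [BBKB.Trajectory.batchSigma, BBKB.Trajectory.dict, hs]
      rw [this, hs]
      exact hcond
    · omega
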